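/- A frequency is a strictly increasing sequence $\lambda=(\lambda_n)$ of non-negative reals with $\lambda_n\to\infty$. For a $\lambda$-Dirichlet series $D=\sum a_ne^{-\lambda_ns}$ and $k\ge 0$ put $R_x^{\lambda,k}(D)(s)=\sum_{\lambda_n<x}a_ne^{-\lambda_ns}\bigl(1-\frac{\lambda_n}{x}\bigr)^k$; $D$ is $(\lambda,k)$-Riesz summable at $s$ with limit $z$ if $R_x^{\lambda,k}(D)(s)\to z$ as $x\to\infty$. $D$ is a $\lambda$-Riesz germ of $f\colon[\mathrm{Re}>0]\to\mathbb C$ if for some $m\ge0$ and some $\sigma\in\mathbb{R}$ it is $(\lambda,m)$-Riesz summable with limit $f(s)$ at all $s$ with $\mathrm{Re}\,s>\max(\sigma,0)$; such a germ is unique if it exists, and its coefficients are the Bohr coefficients $a_n(f)$ of $f$. For $\ell\ge 0$ let $H_{\infty,\ell}^\lambda[\mathrm{Re}>0]$ be the space of holomorphic $f$ on $[\mathrm{Re}>0]$ that have a $\lambda$-Riesz germ and satisfy $\|f\|_{\infty,\ell}=\sup_{\mathrm{Re}\,s>0}\frac{|f(s)|}{(1+|s|)^\ell}<\infty$. Let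 $\mathcal D_{\infty,\ell}(\lambda)$ be the space of all $\lambda$-Dirichlet series $D$ that are $(\lambda,\ell)$-Riesz summable on $[\mathrm{Re}>0]$ with limit function $f\in H_{\infty,\ell}^\lambda[\mathrm{Re}>0]$, with $\|D\|_{\infty,\ell}=\|f\|_{\infty,\ell}$. Let $\sigma_c(D),\sigma_a(D)\in[-\infty,\infty]$ be the abscissas of convergence and of absolute convergence of $D$, and let $L(\lambda)=\sup_D(\sigma_a(D)-\sigma_c(D))$, the supremum over all $\lambda$-Dirichlet series $D$ for which the difference is defined. **Theorem.** Let $\lambda$ be a frequency that satisfies Bohr's condition with constant $\beta>0$, that is, $\frac1{\lambda_{n+1}-\lambda_n}=O(e^{\beta\lambda_n})$, and let $\ell>0$. Then the $\lambda$-Riesz germ of every $f\in H_{\infty,\ell}^\lambda[\mathrm{Re}>0]$ is $(\lambda,\ell)$-Riesz summable on $[\mathrm{Re}>0]$, with limit $f$. Moreover: 1. Montel's theorem holds in $\mathcal D_{\infty,\ell}(\lambda)$: for every bounded sequence $(D_N)$ in $\mathcal D_{\infty,\ell}(\lambda)$ there are a subsequence $(D_{N_j})$ and an $E\in\mathcal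 D_{\infty,\ell}(\lambda)$ such that for every $u>0$ the translations of $D_{N_j}$ by $u$ converge in $\mathcal D_{\infty,\ell}(\lambda)$ to the translation of $E$ by $u$, where the translation of $\sum a_ne^{-\lambda_ns}$ by $u$ is $\sum a_ne^{-\lambda_nu}e^{-\lambda_ns}$. 2. $\mathcal D_{\infty,\ell}(\lambda)$ is a Banach space. 3. $\mathcal D_{\infty,\ell}(\lambda)=H_{\infty,\ell}^\lambda[\mathrm{Re}>0]$ isometrically and coefficient preserving: sending $D$ to its limit function is a linear isometric bijection, and the Bohr coefficients of the limit function are the coefficients of $D$. 4. The $\lambda$-Riesz germ $D$ of every $f\in H_{\infty,\ell}^\lambda[\mathrm{Re}>0]$ satisfies $\sigma_a(D)\le L(\lambda)+\beta\ell<\infty$. -/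

import Mathlib

open Filter Topology
open scoped NNReal

noncomputable section

namespace RieszDirichlet

/-- A frequency: a strictly increasing sequence of non-negative reals tending to `+∞`. -/
structure Frequency where
  /-- the underlying sequence -/
  seq : ℕ → ℝ
  strictMono : StrictMono seq
  nonneg : ∀ n, 0 ≤ seq n
  tendsto_atTop : Tendsto seq atTop atTop

instance : CoeFun Frequency (fun _ => ℕ → ℝ) := ⟨Frequency.seq⟩

/-- The open right half-plane `[Re > 0]`. -/
abbrev RightHalfPlane : Type := {s : ℂ // 0 < s.re}

namespace Frequency

theorem finite_lt (lam : Frequency) (x : ℝ) : {n | lam n < x}.Finite := by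
  have h : ∀ᶠ n in cofinite, x ≤ lam n := by
    rw [Nat.cofinite_eq_atTop]
    exact lam.tendsto_atTop.eventually_ge_atTop x
  simpa [Filter.eventually_cofinite] using h

/-- The finite set of indices `n` with `lam n < x`. -/
def below (lam : Frequency) (x : ℝ) : Finset ℕ := (lam.finite_lt x).toFinset

end Frequency

/-- The Dirichlet series `∑ a n * exp (-lam n * s)` is identified with its coefficients `a`; this
is its Riesz mean `∑_{lam n < x} a n * exp (-lam n * s) * (1 - lam n / x) ^ k` of order `k`. -/
def rieszMean (lam : Frequency) (k : ℝ≥0) (a : ℕ → ℂ) (x : ℝ) (s : ℂ) : ℂ :=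
  ∑ n ∈ lam.below x,
    a n * Complex.exp (-(lam n : ℂ) * s) * (((1 - lam n / x) ^ (k : ℝ) : ℝ) : ℂ)

/-- The Dirichlet series with coefficients `a` is `(lam, k)`-Riesz summable at `s` with limit `z`. -/
def RieszSummableTo (lam : Frequency) (k : ℝ≥0) (a : ℕ → ℂ) (s z : ℂ) : Prop :=
  Tendsto (fun x : ℝ => rieszMean lam k a x s) atTop (𝓝 z)

/-- `f` is holomorphic on `[Re > 0]`. -/
def IsHolomorphic (f : RightHalfPlane → ℂ) : Prop :=
  ∃ F : ℂ → ℂ, DifferentiableOn ℂ F {s : ℂ | 0 < s.re} ∧ ∀ s : RightHalfPlane, F s = f s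

/-- The Dirichlet series with coefficients `a` is a `lam`-Riesz germ of `f`: for some order
`m ≥ 0`, it is `(lam, m)`-Riesz summable with limit `f` on some half-plane `[Re > σ]`. -/
def IsRieszGerm (lam : Frequency) (a : ℕ → ℂ) (f : RightHalfPlane → ℂ) : Prop :=
  ∃ m : ℝ≥0, ∃ σ : ℝ, ∀ s : RightHalfPlane, σ < (s : ℂ).re → RieszSummableTo lam m a s (f s)

/-- The quotient `|f s| / (1 + |s|) ^ ℓ`. -/
def growthQuotient (ℓ : ℝ≥0) (f : RightHalfPlane → ℂ) (s : RightHalfPlane) : ℝ :=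
  ‖f s‖ / (1 + ‖(s : ℂ)‖) ^ (ℓ : ℝ)

/-- The norm `sup_{Re s > 0} |f s| / (1 + |s|) ^ ℓ`, for functions for which it is finite. -/
def growthNorm (ℓ : ℝ≥0) (f : RightHalfPlane → ℂ) : ℝ :=
  ⨆ s : RightHalfPlane, growthQuotient ℓ f s

/-- The space `H_{∞,ℓ}^lam[Re > 0]`: holomorphic functions on `[Re > 0]` that have a `lam`-Riesz
germ and for which `|f s| / (1 + |s|) ^ ℓ` is bounded. -/
def HSpace (lam : Frequency) (ℓ : ℝ≥0) : Set (RightHalfPlane → ℂ) :=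
  {f | IsHolomorphic f ∧ (∃ a, IsRieszGerm lam a f) ∧ BddAbove (Set.range (growthQuotient ℓ f))}

open Classical in
/-- The Bohr coefficients of `f`: the coefficients of its `lam`-Riesz germ. -/
def bohrCoeff (lam : Frequency) (f : RightHalfPlane → ℂ) : ℕ → ℂ :=
  if h : ∃ a, IsRieszGerm lam a f then h.choose else 0

/-! ### The space of Riesz summable Dirichlet series -/

theorem RieszSummableTo.add {lam : Frequency} {k : ℝ≥0} {a b : ℕ → ℂ} {s z w : ℂ}
    (ha : RieszSummableTo lam k a s z) (hb : RieszSummableTo lam k b s w) :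
    RieszSummableTo lam k (a + b) s (z + w) := by
  refine (Tendsto.add ha hb).congr fun x => ?_
  simp only [rieszMean, ← Finset.sum_add_distrib, Pi.add_apply, add_mul]

theorem RieszSummableTo.smul {lam : Frequency} {k : ℝ≥0} {a : ℕ → ℂ} {s z : ℂ} (c : ℂ)
    (ha : RieszSummableTo lam k a s z) : RieszSummableTo lam k (c • a) s (c * z) := by
  refine (Tendsto.const_mul c ha).congr fun x => ?_
  simp only [rieszMean, Finset.mul_sum, Pi.smul_apply, smul_eq_mul, mul_assoc]

theorem RieszSummableTo.zero (lam : Frequency) (k : ℝ≥0) (s : ℂ) :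
    RieszSummableTo lam k 0 s 0 := by
  simp [RieszSummableTo, rieszMean]

theorem growthQuotient_add_le (ℓ : ℝ≥0) (f g : RightHalfPlane → ℂ) (s : RightHalfPlane) :
    growthQuotient ℓ (f + g) s ≤ growthQuotient ℓ f s + growthQuotient ℓ g s := by
  simp only [growthQuotient, ← add_div, Pi.add_apply]
  gcongr
  exact norm_add_le _ _

theorem growthQuotient_smul (ℓ : ℝ≥0) (c : ℂ) (f : RightHalfPlane → ℂ) (s : RightHalfPlane) :
    growthQuotient ℓ (c • f) s = ‖c‖ * growthQuotient ℓ f s := by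
  simp [growthQuotient, mul_div_assoc]

theorem growthQuotient_nonneg (ℓ : ℝ≥0) (f : RightHalfPlane → ℂ) (s : RightHalfPlane) :
    0 ≤ growthQuotient ℓ f s := by
  unfold growthQuotient
  positivity

/-- The Dirichlet series that are `(lam, ℓ)`-Riesz summable on all of `[Re > 0]` and whose limit
function belongs to `H_{∞,ℓ}^lam[Re > 0]`, as a space of coefficient sequences. -/
def dirichletSubmodule (lam : Frequency) (ℓ : ℝ≥0) : Submodule ℂ (ℕ → ℂ) where
  carrier := {a | ∃ f ∈ HSpace lam ℓ, ∀ s : RightHalfPlane, RieszSummableTo lam ℓ a s (f s)}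
  zero_mem' := by
    have h : ∀ s : RightHalfPlane,
        RieszSummableTo lam ℓ 0 s ((0 : RightHalfPlane → ℂ) s) :=
      fun s => RieszSummableTo.zero lam ℓ s
    refine ⟨0, ⟨⟨0, differentiableOn_const 0, fun _ => rfl⟩, ⟨0, ℓ, 0, fun s _ => h s⟩, 0, ?_⟩, h⟩
    rintro _ ⟨s, rfl⟩
    simp [growthQuotient]
  add_mem' := by
    rintro a b ⟨f, ⟨⟨F, hF, hFf⟩, -, ⟨A, hA⟩⟩, haf⟩ ⟨g, ⟨⟨G, hG, hGg⟩, -, ⟨B, hB⟩⟩, hbg⟩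
    have h : ∀ s : RightHalfPlane, RieszSummableTo lam ℓ (a + b) s ((f + g) s) :=
      fun s => (haf s).add (hbg s)
    refine ⟨f + g, ⟨⟨F + G, hF.add hG, fun s => ?_⟩, ⟨a + b, ℓ, 0, fun s _ => h s⟩, A + B, ?_⟩, h⟩
    · simp [hFf, hGg]
    · rintro _ ⟨s, rfl⟩
      exact (growthQuotient_add_le ℓ f g s).trans (add_le_add (hA ⟨s, rfl⟩) (hB ⟨s, rfl⟩))
  smul_mem' := by
    rintro c a ⟨f, ⟨⟨F, hF, hFf⟩, -, ⟨A, hA⟩⟩, haf⟩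
    have h : ∀ s : RightHalfPlane, RieszSummableTo lam ℓ (c • a) s ((c • f) s) :=
      fun s => (haf s).smul c
    refine ⟨c • f, ⟨⟨c • F, hF.const_smul c, fun s => ?_⟩, ⟨c • a, ℓ, 0, fun s _ => h s⟩,
      ‖c‖ * A, ?_⟩, h⟩
    · simp [hFf]
    · rintro _ ⟨s, rfl⟩
      rw [growthQuotient_smul]
      exact mul_le_mul_of_nonneg_left (hA ⟨s, rfl⟩) (norm_nonneg c)

/-- The space `D_{∞,ℓ}(lam)`. It is a type of its own so that its topology is the one of its norm
and not the one of coefficientwise convergence. -/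
def DSpace (lam : Frequency) (ℓ : ℝ≥0) : Type := ↥(dirichletSubmodule lam ℓ)

namespace DSpace

variable {lam : Frequency} {ℓ : ℝ≥0}

instance : AddCommGroup (DSpace lam ℓ) := inferInstanceAs (AddCommGroup ↥(dirichletSubmodule lam ℓ))

instance : Module ℂ (DSpace lam ℓ) := inferInstanceAs (Module ℂ ↥(dirichletSubmodule lam ℓ))

/-- The coefficients of a Dirichlet series in `D_{∞,ℓ}(lam)`. -/
def coeff : DSpace lam ℓ →ₗ[ℂ] (ℕ → ℂ) := (dirichletSubmodule lam ℓ).subtype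

theorem coeff_mem (D : DSpace lam ℓ) :
    ∃ f ∈ HSpace lam ℓ, ∀ s : RightHalfPlane, RieszSummableTo lam ℓ D.coeff s (f s) :=
  D.2

/-- The limit function `s ↦ lim_{x → ∞} R_x(D)(s)`, with Riesz means of order `ℓ`. -/
def limitFun (D : DSpace lam ℓ) (s : RightHalfPlane) : ℂ :=
  limUnder atTop (fun x : ℝ => rieszMean lam ℓ D.coeff x s)

theorem limitFun_eq {D : DSpace lam ℓ} {f : RightHalfPlane → ℂ}
    (h : ∀ s : RightHalfPlane, RieszSummableTo lam ℓ D.coeff s (f s)) : D.limitFun = f :=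
  funext fun s => (h s).limUnder_eq

theorem summable_limitFun (D : DSpace lam ℓ) (s : RightHalfPlane) :
    RieszSummableTo lam ℓ D.coeff s (D.limitFun s) := by
  obtain ⟨f, -, hf⟩ := D.coeff_mem
  rw [limitFun_eq hf]
  exact hf s

theorem limitFun_mem (D : DSpace lam ℓ) : D.limitFun ∈ HSpace lam ℓ := by
  obtain ⟨f, hfH, hf⟩ := D.coeff_mem
  rwa [limitFun_eq hf]

/-- The map that sends a Dirichlet series in `D_{∞,ℓ}(lam)` to its limit function. -/
def limitMap : DSpace lam ℓ →ₗ[ℂ] (RightHalfPlane → ℂ) where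
  toFun := limitFun
  map_add' D E := limitFun_eq fun s => by
    rw [map_add]
    exact (D.summable_limitFun s).add (E.summable_limitFun s)
  map_smul' c D := limitFun_eq fun s => by
    rw [map_smul]
    exact (D.summable_limitFun s).smul c

theorem limitMap_bdd (D : DSpace lam ℓ) : BddAbove (Set.range (growthQuotient ℓ (limitMap D))) :=
  D.limitFun_mem.2.2

/-- The norm `‖D‖ = sup_{Re s > 0} |f s| / (1 + |s|) ^ ℓ`, where `f` is the limit function. -/
def addGroupSeminorm (lam : Frequency) (ℓ : ℝ≥0) : AddGroupSeminorm (DSpace lam ℓ) where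
  toFun D := growthNorm ℓ (limitMap D)
  map_zero' := by simp [growthNorm, growthQuotient]
  add_le' D E := by
    have : Nonempty RightHalfPlane := ⟨⟨1, by simp⟩⟩
    refine ciSup_le fun s => ?_
    rw [map_add]
    exact (growthQuotient_add_le ℓ _ _ s).trans
      (add_le_add (le_ciSup D.limitMap_bdd s) (le_ciSup E.limitMap_bdd s))
  neg' D := by simp [growthNorm, growthQuotient]

instance : SeminormedAddCommGroup (DSpace lam ℓ) :=
  (addGroupSeminorm lam ℓ).toSeminormedAddCommGroup

theorem norm_eq (D : DSpace lam ℓ) : ‖D‖ = growthNorm ℓ (limitMap D) := rfl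

instance : NormedSpace ℂ (DSpace lam ℓ) where
  norm_smul_le c D := by
    have : Nonempty RightHalfPlane := ⟨⟨1, by simp⟩⟩
    rw [norm_eq, norm_eq, map_smul]
    refine ciSup_le fun s => ?_
    rw [growthQuotient_smul]
    exact mul_le_mul_of_nonneg_left (le_ciSup D.limitMap_bdd s) (norm_nonneg c)

/-- The point `u + s` of the right half-plane. -/
def shift (u : ℝ) (hu : 0 < u) (s : RightHalfPlane) : RightHalfPlane :=
  ⟨u + s, by simpa using add_pos hu s.2⟩

theorem translate_mem (u : ℝ) (hu : 0 < u) (D : DSpace lam ℓ) :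
    (fun n => D.coeff n * Complex.exp (-(lam n : ℂ) * u)) ∈ dirichletSubmodule lam ℓ := by
  obtain ⟨f, ⟨⟨F, hF, hFf⟩, -, ⟨A, hA⟩⟩, hf⟩ := D.coeff_mem
  have h : ∀ s : RightHalfPlane, RieszSummableTo lam ℓ
      (fun n => D.coeff n * Complex.exp (-(lam n : ℂ) * u)) s (f (shift u hu s)) := by
    intro s
    refine Tendsto.congr (fun x => ?_) (hf (shift u hu s))
    refine Finset.sum_congr rfl fun n _ => ?_
    simp only [shift, mul_add, Complex.exp_add, mul_assoc]
  refine ⟨fun s => f (shift u hu s), ⟨⟨fun s => F (u + s), ?_, fun s => hFf (shift u hu s)⟩,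
    ⟨_, ℓ, 0, fun s _ => h s⟩, A * (1 + u) ^ (ℓ : ℝ), ?_⟩, h⟩
  · refine hF.comp (by fun_prop) fun s hs => ?_
    simpa using add_pos hu hs
  · rintro _ ⟨s, rfl⟩
    have h1 : growthQuotient ℓ f (shift u hu s) ≤ A := hA ⟨_, rfl⟩
    have hs : 0 ≤ ‖(s : ℂ)‖ := norm_nonneg _
    have h2 : 1 + ‖((shift u hu s : RightHalfPlane) : ℂ)‖ ≤ (1 + u) * (1 + ‖(s : ℂ)‖) := by
      have : ‖((shift u hu s : RightHalfPlane) : ℂ)‖ ≤ u + ‖(s : ℂ)‖ := by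
        refine (norm_add_le (u : ℂ) (s : ℂ)).trans ?_
        simp [abs_of_pos hu]
      nlinarith
    have h3 : (1 + ‖((shift u hu s : RightHalfPlane) : ℂ)‖) ^ (ℓ : ℝ) ≤
        (1 + u) ^ (ℓ : ℝ) * (1 + ‖(s : ℂ)‖) ^ (ℓ : ℝ) := by
      rw [← Real.mul_rpow (by positivity) (by positivity)]
      exact Real.rpow_le_rpow (by positivity) h2 ℓ.2
    have hA0 : 0 ≤ A := (growthQuotient_nonneg ℓ f _).trans h1
    unfold growthQuotient at h1 ⊢
    rw [div_le_iff₀ (by positivity)] at h1 ⊢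
    calc ‖f (shift u hu s)‖ ≤ _ := h1
      _ ≤ A * ((1 + u) ^ (ℓ : ℝ) * (1 + ‖(s : ℂ)‖) ^ (ℓ : ℝ)) :=
        mul_le_mul_of_nonneg_left h3 hA0
      _ = _ := by ring

/-- The translation `∑ a n * exp (-lam n * u) * exp (-lam n * s)` of `∑ a n * exp (-lam n * s)`. -/
def translate (u : ℝ) (hu : 0 < u) (D : DSpace lam ℓ) : DSpace lam ℓ :=
  ⟨fun n => D.coeff n * Complex.exp (-(lam n : ℂ) * u), translate_mem u hu D⟩

end DSpace

/-- Montel's theorem holds in `D_{∞,ℓ}(lam)`: every bounded sequence has a subsequence all of whose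
translations by `u > 0` converge in norm to the translation of one and the same element. -/
def MontelHolds (lam : Frequency) (ℓ : ℝ≥0) : Prop :=
  ∀ D : ℕ → DSpace lam ℓ, (∃ C : ℝ, ∀ N, ‖D N‖ ≤ C) →
    ∃ φ : ℕ → ℕ, StrictMono φ ∧ ∃ E : DSpace lam ℓ, ∀ (u : ℝ) (hu : 0 < u),
      Tendsto (fun j => DSpace.translate u hu (D (φ j))) atTop (𝓝 (DSpace.translate u hu E))

/-- `D_{∞,ℓ}(lam)` is a Banach space: its seminorm is a norm, and it is complete. -/
def IsBanachDSpace (lam : Frequency) (ℓ : ℝ≥0) : Prop :=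
  (∀ D : DSpace lam ℓ, ‖D‖ = 0 → D = 0) ∧ CompleteSpace (DSpace lam ℓ)

/-- The `lam`-Riesz germ of every `f` in `H_{∞,ℓ}^lam[Re > 0]` is `(lam, ℓ)`-Riesz summable
on `[Re > 0]`, with limit `f`. -/
def GermsSummable (lam : Frequency) (ℓ : ℝ≥0) : Prop :=
  ∀ f ∈ HSpace lam ℓ, ∀ a : ℕ → ℂ, IsRieszGerm lam a f →
    ∀ s : RightHalfPlane, RieszSummableTo lam ℓ a s (f s)

/-- `D_{∞,ℓ}(lam) = H_{∞,ℓ}^lam[Re > 0]` isometrically and coefficient preserving: sending a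
Dirichlet series to its limit function is a (linear) bijection that preserves norms and
coefficients. -/
def SpacesCoincide (lam : Frequency) (ℓ : ℝ≥0) : Prop :=
  Set.BijOn (DSpace.limitMap : DSpace lam ℓ →ₗ[ℂ] (RightHalfPlane → ℂ)) Set.univ (HSpace lam ℓ) ∧
    ∀ D : DSpace lam ℓ,
      growthNorm ℓ (DSpace.limitMap D) = ‖D‖ ∧ bohrCoeff lam (DSpace.limitMap D) = D.coeff

/-! ### Abscissas and Bohr's condition -/

/-- The abscissa of convergence of `∑ a n * exp (-lam n * s)`. -/
def abscissaConv (lam : Frequency) (a : ℕ → ℂ) : EReal :=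
  sInf ((fun σ : ℝ => (σ : EReal)) '' {σ : ℝ | ∃ z : ℂ, Tendsto
    (fun N => ∑ n ∈ Finset.range N, a n * Complex.exp (-(lam n : ℂ) * σ)) atTop (𝓝 z)})

/-- The abscissa of absolute convergence of `∑ a n * exp (-lam n * s)`. -/
def abscissaAbsConv (lam : Frequency) (a : ℕ → ℂ) : EReal :=
  sInf ((fun σ : ℝ => (σ : EReal)) ''
    {σ : ℝ | Summable fun n => ‖a n * Complex.exp (-(lam n : ℂ) * σ)‖})

/-- `L(lam)`, the supremum of `σ_a(D) - σ_c(D)` over all Dirichlet series `D` with frequency `lam`.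
An undefined difference (`∞ - ∞`, both abscissas equal to `∞` or both to `-∞`) is `⊥` in `EReal`,
so that it does not contribute. -/
def stripWidth (lam : Frequency) : EReal :=
  ⨆ a : ℕ → ℂ, abscissaAbsConv lam a - abscissaConv lam a

/-- Bohr's condition with constant `β`: `1 / (lam (n + 1) - lam n) = O(exp (β * lam n))`. -/
def BohrCondition (lam : Frequency) (β : ℝ) : Prop :=
  (fun n => 1 / (lam (n + 1) - lam n)) =O[atTop] fun n => Real.exp (β * lam n)

end RieszDirichlet

end

noncomputable section

namespace RieszDirichlet

open MeasureTheory Set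
open scoped ContDiff

/-! Everything rests on one estimate, `HasDirichletExpansion.norm_tsum_le`. Suppose F is holomorphic
on [Re > 0] with |F(s)| ≤ A(1+|s|)^ℓ and is the sum of ∑ a_n e^{-λ_n s} on some half-plane of
absolute convergence. For a smooth φ supported in [-1,1], Perron's formula writes ∑ a_n φ((λ_n -
y)/t) as an integral of F against the rescaled Laplace transform of φ. That transform decays faster
than any power, so the contour can be moved to Re s = ε and ε sent to 0. The result is O(A t^{-ℓ})
for 0 < t ≤ 1, uniformly in the centre y.

Different widths t then serve different ends. Taking t to be the gap c e^{-βλ_n} isolates one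
coefficient and gives |a_n| = O(A e^{βℓλ_n}) (`exists_norm_coeff_le`); this yields uniqueness,
compactness of coefficient sequences and the bound on σ_a. Taking t = 1 shows that smooth blocks of
frequencies near m, evaluated at distance u inside the half-plane, are O(e^{-um}), so their sum
represents F on all of [Re > 0].

For the Riesz means of order ℓ, the weight (x - λ)^ℓ is singular only at λ = x, and it is resolved
there dyadically. The piece at scale 2^{-j} has height 2^{-jℓ}, which exactly cancels the loss
t^{-ℓ} = 2^{jℓ}, so each piece contributes O(e^{-ux}). After O(x) pieces the scale is below the gap,
at most one frequency is left, and the coefficient bound controls it. The total error O(x e^{-ux})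
vanishes (`HasDirichletExpansion.rieszSummableTo_ofReal`).

To enter this setting, a germ summable of some unknown order must converge absolutely somewhere.
Finite differences of its Riesz sums bound its terms exponentially, and ∑ e^{-2βλ_n} < ∞ by Bohr's
condition (`IsRieszGerm.exists_expansion`). Montel's theorem follows because, on bounded sets,
finitely many coefficients determine a translated function up to a small error; completeness follows
from Montel's theorem. The abscissa bound compares D with the alternating series ∑ (-1)^n e^{-λ_n
s}. -/

/-! ### Laplace transforms of test functions -/

/-- The two-sided Laplace transform `z ↦ ∫ φ t * exp (z * t)`. -/
def laplace (φ : ℝ → ℂ) (z : ℂ) : ℂ := ∫ t : ℝ, φ t * Complex.exp (z * t)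

theorem tsupport_subset_Icc {φ : ℝ → ℂ} {a b : ℝ} (h : Function.support φ ⊆ Icc a b) :
    tsupport φ ⊆ Icc a b :=
  closure_minimal h isClosed_Icc

theorem hasCompactSupport_of_support_subset_Icc {φ : ℝ → ℂ} {a b : ℝ}
    (h : Function.support φ ⊆ Icc a b) : HasCompactSupport φ :=
  HasCompactSupport.of_support_subset_isCompact isCompact_Icc h

theorem support_deriv_subset_Icc {φ : ℝ → ℂ} {a b : ℝ} (h : Function.support φ ⊆ Icc a b) :
    Function.support (deriv φ) ⊆ Icc a b :=
  support_deriv_subset.trans (tsupport_subset_Icc h)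

theorem support_iteratedDeriv_subset_Icc {φ : ℝ → ℂ} {a b : ℝ}
    (h : Function.support φ ⊆ Icc a b) (K : ℕ) :
    Function.support (iteratedDeriv K φ) ⊆ Icc a b := by
  induction K with
  | zero => simpa [iteratedDeriv_zero] using h
  | succ K ih => rw [iteratedDeriv_succ]; exact support_deriv_subset_Icc ih

theorem integrable_mul_exp {φ : ℝ → ℂ} (hφ : Continuous φ) (hc : HasCompactSupport φ) (z : ℂ) :
    Integrable fun t : ℝ => φ t * Complex.exp (z * t) :=
  Continuous.integrable_of_hasCompactSupport (by fun_prop) hc.mul_right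

theorem mul_laplace {φ : ℝ → ℂ} (hφ : ContDiff ℝ ∞ φ) (hc : HasCompactSupport φ) (z : ℂ) :
    z * laplace φ z = -laplace (deriv φ) z := by
  have hd : Continuous (deriv φ) := hφ.continuous_deriv (by simp)
  have h := integral_mul_deriv_eq_deriv_mul_of_integrable (u := φ) (u' := deriv φ)
    (v := fun t : ℝ => Complex.exp (z * t)) (v' := fun t : ℝ => z * Complex.exp (z * t))
    (fun x _ => (hφ.differentiable (by simp) x).hasDerivAt)
    (fun x _ => by
      have h1 : HasDerivAt (fun t : ℝ => z * (t : ℂ)) z x := by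
        simpa using (Complex.ofRealCLM.hasDerivAt (x := x)).const_mul z
      simpa [mul_comm] using h1.cexp)
    (by
      have := (integrable_mul_exp hφ.continuous hc z).const_mul z
      refine this.congr (Eventually.of_forall fun t => ?_)
      simp only [Pi.mul_apply]; ring)
    (integrable_mul_exp hd hc.deriv z) (integrable_mul_exp hφ.continuous hc z)
  rw [laplace, laplace, ← h, ← integral_const_mul]
  refine integral_congr_ae (Eventually.of_forall fun t => ?_)
  ring

theorem pow_mul_laplace {φ : ℝ → ℂ} (hφ : ContDiff ℝ ∞ φ) (hc : HasCompactSupport φ) (z : ℂ)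
    (K : ℕ) : z ^ K * laplace φ z = (-1) ^ K * laplace (iteratedDeriv K φ) z := by
  induction K generalizing φ with
  | zero => simp
  | succ K ih =>
    rw [pow_succ, mul_assoc, mul_laplace hφ hc, mul_neg,
      ih ((contDiff_infty_iff_deriv.1 hφ).2) hc.deriv, iteratedDeriv_succ']
    ring

theorem norm_laplace_le {φ : ℝ → ℂ} {M : ℝ} (hs : Function.support φ ⊆ Icc (-1) 1)
    (hM : ∀ t, ‖φ t‖ ≤ M) (z : ℂ) : ‖laplace φ z‖ ≤ 2 * M * Real.exp |z.re| := by
  have h : laplace φ z = ∫ t in Icc (-1 : ℝ) 1, φ t * Complex.exp (z * t) := by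
    rw [laplace, setIntegral_eq_integral_of_forall_compl_eq_zero]
    intro t ht
    rw [Function.notMem_support.1 fun h => ht (hs h), zero_mul]
  have hM0 : 0 ≤ M := (norm_nonneg _).trans (hM 0)
  rw [h]
  refine (norm_setIntegral_le_of_norm_le_const (C := M * Real.exp |z.re|) (by simp) ?_).trans ?_
  · intro t ht
    rw [norm_mul, Complex.norm_exp]
    refine mul_le_mul (hM t) (Real.exp_le_exp.2 ?_) (Real.exp_pos _).le hM0
    simp only [Complex.mul_re, Complex.ofReal_re, Complex.ofReal_im, mul_zero, sub_zero]
    calc z.re * t ≤ |z.re * t| := le_abs_self _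
      _ = |z.re| * |t| := abs_mul _ _
      _ ≤ |z.re| * 1 := by gcongr; exact abs_le.2 ht
      _ = |z.re| := mul_one _
  · simp only [Measure.real, Real.volume_Icc, sub_neg_eq_add]
    rw [ENNReal.toReal_ofReal (by norm_num)]
    linarith

/-- The direct bound serves |z| ≤ 1 and K integrations by parts serve |z| ≥ 1; in both cases
replacing the respective quantity by 1+|z| costs 2^K. -/
theorem norm_laplace_le_div {φ : ℝ → ℂ} {M : ℝ} {K : ℕ} (hφ : ContDiff ℝ ∞ φ)
    (hs : Function.support φ ⊆ Icc (-1) 1) (hM : ∀ t, ‖φ t‖ ≤ M)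
    (hMK : ∀ t, ‖iteratedDeriv K φ t‖ ≤ M) (z : ℂ) :
    ‖laplace φ z‖ ≤ 2 ^ (K + 1) * M * Real.exp |z.re| / (1 + ‖z‖) ^ K := by
  have hc := hasCompactSupport_of_support_subset_Icc hs
  have hM0 : 0 ≤ M := (norm_nonneg _).trans (hM 0)
  have h1 := norm_laplace_le hs hM z
  have h2 : ‖z‖ ^ K * ‖laplace φ z‖ ≤ 2 * M * Real.exp |z.re| := by
    rw [← norm_pow, ← norm_mul, pow_mul_laplace hφ hc z K, norm_mul]
    simpa using norm_laplace_le (support_iteratedDeriv_subset_Icc hs K) hMK z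
  rw [le_div_iff₀ (by positivity)]
  rcases le_total ‖z‖ 1 with hz | hz
  · calc ‖laplace φ z‖ * (1 + ‖z‖) ^ K ≤ (2 * M * Real.exp |z.re|) * 2 ^ K := by
          gcongr; linarith
      _ = _ := by ring
  · calc ‖laplace φ z‖ * (1 + ‖z‖) ^ K ≤ ‖laplace φ z‖ * (2 * ‖z‖) ^ K := by
          gcongr; linarith
      _ = (‖z‖ ^ K * ‖laplace φ z‖) * 2 ^ K := by ring
      _ ≤ (2 * M * Real.exp |z.re|) * 2 ^ K := by gcongr
      _ = _ := by ring

theorem differentiable_laplace {φ : ℝ → ℂ} (hφ : Continuous φ) (hc : HasCompactSupport φ) :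
    Differentiable ℂ (laplace φ) := by
  intro z
  have hb : Continuous fun t : ℝ => ‖φ t‖ * (|t| * Real.exp ((‖z‖ + 1) * |t|)) := by fun_prop
  refine (hasDerivAt_integral_of_dominated_loc_of_deriv_le (Metric.ball_mem_nhds z one_pos)
    (F := fun z (t : ℝ) => φ t * Complex.exp (z * t))
    (F' := fun z (t : ℝ) => φ t * (t * Complex.exp (z * t)))
    (bound := fun t => ‖φ t‖ * (|t| * Real.exp ((‖z‖ + 1) * |t|)))
    (Eventually.of_forall fun w => (by fun_prop : Continuous _).aestronglyMeasurable)
    (integrable_mul_exp hφ hc z) (by fun_prop : Continuous _).aestronglyMeasurable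
    (Eventually.of_forall fun t w hw => ?_)
    (hb.integrable_of_hasCompactSupport hc.norm.mul_right)
    (Eventually.of_forall fun t w _ => ?_)).2.differentiableAt
  · rw [norm_mul, norm_mul, Complex.norm_exp, Complex.norm_real, Real.norm_eq_abs]
    gcongr
    calc (w * t).re ≤ ‖w * t‖ := Complex.re_le_norm _
      _ = ‖w‖ * |t| := by simp
      _ ≤ (‖z‖ + 1) * |t| := by
        gcongr
        have := norm_le_norm_add_norm_sub' w z
        rw [← dist_eq_norm w z] at this
        have := Metric.mem_ball.1 hw
        linarith
  · have h1 : HasDerivAt (fun w : ℂ => w * (t : ℂ)) t w := by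
      simpa using (hasDerivAt_id w).mul_const (t : ℂ)
    simpa [mul_comm] using h1.cexp.const_mul (φ t)

theorem integrable_inv_one_add_norm_sq (c : ℝ) :
    Integrable fun τ : ℝ => ((1 + ‖(c : ℂ) + τ * Complex.I‖) ^ 2)⁻¹ := by
  have hcont : Continuous fun τ : ℝ => ((1 + ‖(c : ℂ) + τ * Complex.I‖) ^ 2)⁻¹ :=
    Continuous.inv₀ (by fun_prop) fun τ => by positivity
  refine integrable_inv_one_add_sq.mono' hcont.aestronglyMeasurable
    (Eventually.of_forall fun τ => ?_)
  rw [Real.norm_of_nonneg (by positivity)]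
  refine inv_anti₀ (by positivity) ?_
  have h1 : |τ| ≤ ‖(c : ℂ) + τ * Complex.I‖ := by
    simpa using Complex.abs_im_le_norm ((c : ℂ) + τ * Complex.I)
  nlinarith [sq_abs τ, abs_nonneg τ]

theorem integrable_laplace_line {φ : ℝ → ℂ} (hφ : ContDiff ℝ ∞ φ)
    (hs : Function.support φ ⊆ Icc (-1) 1) (c : ℝ) :
    Integrable fun τ : ℝ => laplace φ (c + τ * Complex.I) := by
  have hc := hasCompactSupport_of_support_subset_Icc hs
  obtain ⟨M₁, hM₁⟩ := hφ.continuous.bounded_above_of_compact_support hc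
  obtain ⟨M₂, hM₂⟩ := (hφ.continuous_iteratedDeriv 2 (by norm_cast)).bounded_above_of_compact_support
    (hasCompactSupport_of_support_subset_Icc (support_iteratedDeriv_subset_Icc hs 2))
  have h := fun z => norm_laplace_le_div (K := 2) (M := max M₁ M₂) hφ hs
    (fun t => (hM₁ t).trans (le_max_left _ _)) (fun t => (hM₂ t).trans (le_max_right _ _)) z
  refine ((integrable_inv_one_add_norm_sq c).const_mul
    (2 ^ (2 + 1) * max M₁ M₂ * Real.exp |c|)).mono' ?_ (Eventually.of_forall fun τ => ?_)
  · have := (differentiable_laplace hφ.continuous hc).continuous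
    exact (by fun_prop : Continuous _).aestronglyMeasurable
  · simpa [div_eq_mul_inv] using h (c + τ * Complex.I)

/-- Fourier inversion for φ(t)e^{ct}, whose Fourier transform at w is the Laplace transform of φ at
c - 2πiw; the factor 2π comes from the substitution τ = -2πw. -/
theorem integral_laplace_mul_exp {φ : ℝ → ℂ} (hφ : ContDiff ℝ ∞ φ)
    (hs : Function.support φ ⊆ Icc (-1) 1) (c x : ℝ) :
    ∫ τ : ℝ, laplace φ (c + τ * Complex.I) * Complex.exp (-(x * (c + τ * Complex.I))) =
      2 * Real.pi * φ x := by
  have hc := hasCompactSupport_of_support_subset_Icc hs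
  set g : ℝ → ℂ := fun t => φ t * Complex.exp (c * t) with hg
  have hgc : Continuous g := by have := hφ.continuous; fun_prop
  have hF : ∀ w : ℝ, FourierTransform.fourier g w =
      laplace φ (c + ((-(2 * Real.pi)) * w : ℝ) * Complex.I) := by
    intro w
    rw [Real.fourier_real_eq_integral_exp_smul, laplace]
    refine integral_congr_ae (Eventually.of_forall fun t => ?_)
    simp only [hg, smul_eq_mul]
    rw [mul_comm, mul_assoc, ← Complex.exp_add]
    congr 2
    push_cast
    ring
  have hpi : (-(2 * Real.pi)) ≠ 0 := by simp [Real.pi_ne_zero]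
  have hFi : Integrable (FourierTransform.fourier g) := by
    rw [funext hF]
    exact (integrable_laplace_line hφ hs c).comp_mul_left' hpi
  have hinv := congrFun (hgc.fourierInv_fourier_eq (integrable_mul_exp hφ.continuous hc c) hFi) x
  rw [Real.fourierInv_eq'] at hinv
  simp_rw [hF] at hinv
  set G : ℝ → ℂ := fun τ => laplace φ (c + τ * Complex.I) *
    Complex.exp (-(x * (c + τ * Complex.I))) with hG
  have h1 : ∫ w : ℝ, G ((-(2 * Real.pi)) * w) = Complex.exp (-(x * c)) * g x := by
    rw [← hinv, ← integral_const_mul]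
    refine integral_congr_ae (Eventually.of_forall fun w => ?_)
    simp only [hG, smul_eq_mul]
    rw [← mul_assoc, ← Complex.exp_add, mul_comm]
    congr 2
    simp
    ring
  rw [Measure.integral_comp_mul_left] at h1
  have h2 : Complex.exp (-(x * c)) * g x = φ x := by
    simp only [hg]
    rw [mul_left_comm, ← Complex.exp_add, show -((x : ℂ) * c) + c * x = 0 by ring]
    simp
  rw [h2] at h1
  rw [← h1, abs_inv, abs_neg, abs_of_pos (by positivity), Complex.real_smul]
  push_cast
  field_simp

/-! ### Perron's formula for test functions -/

/-- Cauchy's theorem on [ε,c] × [-T,T]: the horizontal sides are O(T^{-2}). -/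
theorem integral_line_eq_of_decay {g : ℂ → ℂ} {ε c B : ℝ} (hε : 0 < ε) (hεc : ε ≤ c)
    (hg : DifferentiableOn ℂ g {s : ℂ | 0 < s.re})
    (hB : ∀ s : ℂ, ε ≤ s.re → s.re ≤ c → ‖g s‖ ≤ B * ((1 + ‖s‖) ^ 2)⁻¹) :
    ∫ τ : ℝ, g (ε + τ * Complex.I) = ∫ τ : ℝ, g (c + τ * Complex.I) := by
  have hB0 : 0 ≤ B := by
    have h := (norm_nonneg _).trans (hB ε (by simp) (by simpa using hεc))
    by_contra! hneg
    have : 0 < ((1 + ‖(ε : ℂ)‖) ^ 2)⁻¹ := by positivity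
    nlinarith
  have hint : ∀ x : ℝ, ε ≤ x → x ≤ c → Integrable fun τ : ℝ => g (x + τ * Complex.I) := by
    intro x h1 h2
    refine ((integrable_inv_one_add_norm_sq x).const_mul B).mono' ?_
      (Eventually.of_forall fun τ => hB _ (by simpa using h1) (by simpa using h2))
    have : Continuous fun τ : ℝ => g (x + τ * Complex.I) := by
      refine hg.continuousOn.comp_continuous (by fun_prop) fun τ => ?_
      simpa using hε.trans_le h1
    exact this.aestronglyMeasurable
  have hrect : ∀ T : ℝ, (∫ x : ℝ in ε..c, g (x + (-T : ℝ) * Complex.I)) -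
      (∫ x : ℝ in ε..c, g (x + T * Complex.I)) +
      Complex.I • (∫ y : ℝ in (-T)..T, g (c + y * Complex.I)) -
      Complex.I • (∫ y : ℝ in (-T)..T, g (ε + y * Complex.I)) = 0 := by
    intro T
    have h := Complex.integral_boundary_rect_eq_zero_of_differentiableOn g
      (⟨ε, -T⟩ : ℂ) (⟨c, T⟩ : ℂ) (hg.mono fun s hs => ?_)
    · simpa using h
    · have := hs.1
      simp only [uIcc_of_le hεc, mem_preimage, mem_Icc] at this
      exact hε.trans_le this.1
  -- With u T = -T and u T = T this covers both horizontal sides.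
  have hhor : ∀ (u : ℝ → ℝ), (∀ T, |u T| = |T|) →
      Tendsto (fun T : ℝ => ∫ x : ℝ in ε..c, g (x + (u T : ℝ) * Complex.I)) atTop (𝓝 0) := by
    intro u hu
    have hlim : Tendsto (fun T : ℝ => B * ((1 + |T|) ^ 2)⁻¹ * |c - ε|) atTop (𝓝 0) := by
      have h1 : Tendsto (fun T : ℝ => (1 + |T|) ^ 2) atTop atTop :=
        (tendsto_pow_atTop two_ne_zero).comp (tendsto_atTop_add_const_left _ _ tendsto_abs_atTop_atTop)
      simpa using (h1.inv_tendsto_atTop.const_mul B).mul_const |c - ε|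
    refine squeeze_zero_norm (fun T => ?_) hlim
    refine intervalIntegral.norm_integral_le_of_norm_le_const fun x hx => ?_
    rw [uIoc_of_le hεc] at hx
    refine (hB _ (by simpa using hx.1.le) (by simpa using hx.2)).trans ?_
    gcongr
    rw [← hu T]
    simpa using Complex.abs_im_le_norm ((x : ℂ) + (u T : ℝ) * Complex.I)
  have hvert : ∀ x : ℝ, ε ≤ x → x ≤ c →
      Tendsto (fun T : ℝ => ∫ y : ℝ in (-T)..T, g (x + y * Complex.I)) atTop
        (𝓝 (∫ τ : ℝ, g (x + τ * Complex.I))) := fun x h1 h2 =>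
    intervalIntegral_tendsto_integral (hint x h1 h2) tendsto_neg_atTop_atBot tendsto_id
  have hlim := (((hhor (fun T => -T) fun T => abs_neg T).sub (hhor id fun T => rfl)).add
    ((hvert c hεc le_rfl).const_smul Complex.I)).sub ((hvert ε le_rfl hεc).const_smul Complex.I)
  have hzero := tendsto_nhds_unique hlim (tendsto_const_nhds.congr fun T => (hrect T).symm)
  simp only [sub_zero, zero_add, smul_eq_mul, ← mul_sub, mul_eq_zero, Complex.I_ne_zero,
    false_or] at hzero
  exact (sub_eq_zero.1 hzero).symm

/-- `F` is holomorphic on `[Re > 0]` with `|F s| ≤ A * (1 + |s|) ^ ℓ`, and it is the sum of the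
Dirichlet series with coefficients `a` on some half-plane where that converges absolutely. -/
structure HasDirichletExpansion (lam : Frequency) (ℓ : ℝ) (a : ℕ → ℂ) (F : ℂ → ℂ) (A : ℝ) :
    Prop where
  differentiableOn : DifferentiableOn ℂ F {s : ℂ | 0 < s.re}
  bound : ∀ s : ℂ, 0 < s.re → ‖F s‖ ≤ A * (1 + ‖s‖) ^ ℓ
  series : ∃ c : ℝ, 0 < c ∧ Summable (fun n => ‖a n‖ * Real.exp (-(lam n * c))) ∧
    ∀ s : ℂ, c ≤ s.re → HasSum (fun n => a n * Complex.exp (-(lam n : ℂ) * s)) (F s)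

namespace HasDirichletExpansion

variable {lam : Frequency} {ℓ : ℝ} {a b : ℕ → ℂ} {F G : ℂ → ℂ} {A B : ℝ}

theorem nonneg (h : HasDirichletExpansion lam ℓ a F A) : 0 ≤ A := by
  have h1 := (norm_nonneg _).trans (h.bound 1 (by simp))
  by_contra! hneg
  have : (0 : ℝ) < (1 + ‖(1 : ℂ)‖) ^ ℓ := by positivity
  nlinarith

theorem sub (h : HasDirichletExpansion lam ℓ a F A) (h' : HasDirichletExpansion lam ℓ b G B) :
    HasDirichletExpansion lam ℓ (a - b) (F - G) (A + B) := by
  obtain ⟨c, hc, hs, hF⟩ := h.series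
  obtain ⟨d, hd, ht, hG⟩ := h'.series
  refine ⟨h.differentiableOn.sub h'.differentiableOn, fun s hs => ?_, max c d,
    lt_max_of_lt_left hc, ?_, fun s hs => ?_⟩
  · rw [add_mul]
    exact (norm_sub_le _ _).trans (add_le_add (h.bound s hs) (h'.bound s hs))
  · refine Summable.of_nonneg_of_le (fun n => by positivity) (fun n => ?_) (hs.add ht)
    calc ‖(a - b) n‖ * Real.exp (-(lam n * max c d))
        ≤ (‖a n‖ + ‖b n‖) * Real.exp (-(lam n * max c d)) := by
          gcongr; exact norm_sub_le _ _
      _ ≤ _ := by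
          rw [add_mul]
          have := lam.nonneg n
          gcongr
          · exact le_max_left _ _
          · exact le_max_right _ _
  · refine ((hF s ((le_max_left _ _).trans hs)).sub (hG s ((le_max_right _ _).trans hs))).congr_fun
      fun n => ?_
    simp [sub_mul]

/-- Since 1+|w+s| ≤ (1+|w|)(1+|s|), translation by w costs only the weight at w. Estimates at real
points thereby spread to the half-plane with the correct weight. -/
theorem translate (h : HasDirichletExpansion lam ℓ a F A) (hℓ : 0 ≤ ℓ) {w : ℂ} (hw : 0 < w.re) :
    HasDirichletExpansion lam ℓ (fun n => a n * Complex.exp (-(lam n : ℂ) * w))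
      (fun s => F (w + s)) (A * (1 + ‖w‖) ^ ℓ) := by
  obtain ⟨c, hc, hs, hF⟩ := h.series
  have hA := h.nonneg
  refine ⟨h.differentiableOn.comp (by fun_prop) fun s hs => ?_, fun s hs => ?_, c, hc, ?_,
    fun s hs => ?_⟩
  · simpa using add_pos hw hs
  · refine (h.bound (w + s) (by simpa using add_pos hw hs)).trans ?_
    rw [mul_assoc, ← Real.mul_rpow (by positivity) (by positivity)]
    gcongr
    nlinarith [norm_add_le w s, norm_nonneg w, norm_nonneg s]
  · refine Summable.of_nonneg_of_le (fun n => by positivity) (fun n => ?_) hs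
    rw [norm_mul, Complex.norm_exp]
    gcongr
    refine mul_le_of_le_one_right (norm_nonneg _) (Real.exp_le_one_iff.2 ?_)
    simpa using mul_nonneg (lam.nonneg n) hw.le
  · refine (hF (w + s) (by simpa using add_le_add hw.le hs)).congr_fun fun n => ?_
    rw [mul_assoc, ← Complex.exp_add]
    ring_nf

/-- Perron's formula on a line of absolute convergence. -/
theorem hasSum_perron_of_le (h : HasDirichletExpansion lam ℓ a F A) {φ : ℝ → ℂ}
    (hφ : ContDiff ℝ ∞ φ) (hs : Function.support φ ⊆ Icc (-1) 1) {y t : ℝ} (ht : 0 < t) :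
    ∃ c₀ : ℝ, ∀ c, c₀ ≤ c → HasSum (fun n => 2 * Real.pi * (a n * φ ((lam n - y) / t)))
      (∫ τ : ℝ, F (c + τ * Complex.I) *
        (t * Complex.exp ((c + τ * Complex.I) * y) * laplace φ (t * (c + τ * Complex.I)))) := by
  obtain ⟨c₀, hc₀, hsum, hF⟩ := h.series
  refine ⟨c₀, fun c hc => ?_⟩
  set L : ℝ → ℂ := fun τ =>
    t * Complex.exp ((c + τ * Complex.I) * y) * laplace φ (t * (c + τ * Complex.I)) with hL
  set D : ℕ → ℝ → ℂ := fun n τ =>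
    a n * Complex.exp (-(lam n : ℂ) * (c + τ * Complex.I)) * L τ with hD
  have hlap : Integrable fun τ : ℝ => laplace φ (t * (c + τ * Complex.I)) := by
    refine ((integrable_laplace_line hφ hs (t * c)).comp_mul_left' ht.ne').congr
      (Eventually.of_forall fun τ => ?_)
    simp only
    congr 1
    push_cast
    ring
  have hLi : Integrable L := by
    refine (hlap.norm.const_mul (t * Real.exp (c * y))).mono' ?_ (Eventually.of_forall fun τ => ?_)
    · have := (differentiable_laplace hφ.continuous
        (hasCompactSupport_of_support_subset_Icc hs)).continuous
      exact (by fun_prop : Continuous L).aestronglyMeasurable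
    · simp only [hL, norm_mul, Complex.norm_exp, Complex.norm_real, Real.norm_eq_abs, abs_of_pos ht]
      simp
  have hnorm : ∀ n τ, ‖D n τ‖ = ‖a n‖ * Real.exp (-(lam n * c)) * ‖L τ‖ := by
    intro n τ
    simp only [hD, norm_mul, Complex.norm_exp]
    simp
  have hDi : ∀ n, Integrable (D n) := by
    intro n
    refine (hLi.norm.const_mul (‖a n‖ * Real.exp (-(lam n * c)))).mono' ?_
      (Eventually.of_forall fun τ => (hnorm n τ).le)
    refine AEStronglyMeasurable.mul ?_ hLi.aestronglyMeasurable
    exact (by fun_prop : Continuous _).aestronglyMeasurable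
  have key := hasSum_integral_of_summable_integral_norm hDi (by
    simp_rw [hnorm, integral_const_mul]
    refine Summable.mul_right _ (Summable.of_nonneg_of_le (fun n => by positivity) (fun n => ?_) hsum)
    have := lam.nonneg n
    gcongr)
  -- Substituting tτ for τ reduces each term to the inversion formula at (λ_n - y)/t; the Jacobian
  -- cancels the factor t of the kernel.
  have hval : ∀ n, ∫ τ, D n τ = 2 * Real.pi * (a n * φ ((lam n - y) / t)) := by
    intro n
    have h1 := integral_laplace_mul_exp hφ hs (t * c) ((lam n - y) / t)
    set G : ℝ → ℂ := fun τ => laplace φ ((t * c : ℝ) + τ * Complex.I) *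
      Complex.exp (-(((lam n - y) / t : ℝ) * ((t * c : ℝ) + τ * Complex.I))) with hG
    have h2 : ∀ τ, D n τ = a n * t * G (t * τ) := by
      intro τ
      have ht' : (t : ℂ) ≠ 0 := by exact_mod_cast ht.ne'
      simp only [hD, hL, hG]
      rw [show ((t * c : ℝ) : ℂ) + ((t * τ : ℝ) : ℂ) * Complex.I = t * (c + τ * Complex.I) by
        push_cast; ring]
      rw [show -((((lam n - y) / t : ℝ) : ℂ) * (t * (c + τ * Complex.I))) =
        -(lam n : ℂ) * (c + τ * Complex.I) + (c + τ * Complex.I) * y by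
        push_cast; field_simp; ring]
      rw [Complex.exp_add]
      ring
    simp_rw [h2]
    rw [integral_const_mul, Measure.integral_comp_mul_left, h1, abs_inv, abs_of_pos ht,
      Complex.real_smul]
    have ht' : (t : ℂ) ≠ 0 := by exact_mod_cast ht.ne'
    push_cast
    field_simp
  simp_rw [hval] at key
  have hE : ∀ τ : ℝ, ∑' n, D n τ = F (c + τ * Complex.I) * L τ := fun τ => by
    rw [← (hF (c + τ * Complex.I) (by simpa using hc)).tsum_eq, ← tsum_mul_right]
  simp_rw [hE] at key
  exact key

/-- The basic estimate: sums of the coefficients against a test function of width `t`. -/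
theorem norm_tsum_le (h : HasDirichletExpansion lam ℓ a F A) (hℓ : 0 ≤ ℓ) {K : ℕ}
    (hK : ℓ + 2 ≤ K) {φ : ℝ → ℂ} {M : ℝ} (hφ : ContDiff ℝ ∞ φ)
    (hs : Function.support φ ⊆ Icc (-1) 1) (hM : ∀ r, ‖φ r‖ ≤ M)
    (hMK : ∀ r, ‖iteratedDeriv K φ r‖ ≤ M) (y : ℝ) {t : ℝ} (ht : 0 < t) (ht1 : t ≤ 1) :
    ‖∑' n, a n * φ ((lam n - y) / t)‖ ≤ 2 ^ K * M * A * t ^ (-ℓ) := by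
  have hA := h.nonneg
  have hM0 : 0 ≤ M := (norm_nonneg _).trans (hM 0)
  have hc := hasCompactSupport_of_support_subset_Icc hs
  set g : ℂ → ℂ := fun s => F s * (t * Complex.exp (s * y) * laplace φ (t * s)) with hg
  have hgd : DifferentiableOn ℂ g {s : ℂ | 0 < s.re} := by
    have := differentiable_laplace hφ.continuous hc
    exact h.differentiableOn.mul (by fun_prop : Differentiable ℂ _).differentiableOn
  set C : ℝ := 2 ^ (K + 1) * M * A * t ^ (-ℓ) with hC
  have hC0 : 0 ≤ C := by positivity
  have hgb : ∀ s : ℂ, 0 < s.re →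
      ‖g s‖ ≤ C * Real.exp (s.re * (y + t)) * (t * ((1 + t * ‖s‖) ^ 2)⁻¹) := by
    intro s hs0
    have h1 := h.bound s hs0
    have h2 := norm_laplace_le_div hφ hs hM hMK (t * s)
    have hre : |((t : ℂ) * s).re| = t * s.re := by
      rw [Complex.re_ofReal_mul, abs_of_pos (by positivity)]
    have hn : ‖(t : ℂ) * s‖ = t * ‖s‖ := by simp [abs_of_pos ht]
    rw [hre, hn] at h2
    have hw : 0 < 1 + t * ‖s‖ := by positivity
    -- The only loss in t: 1+|s| ≤ t⁻¹(1+t|s|) because t ≤ 1. Of the K ≥ ℓ+2 powers of decay, ℓ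
    -- absorb the growth of F and two remain for integrability.
    have h3 : (1 + ‖s‖) ^ ℓ ≤ t ^ (-ℓ) * (1 + t * ‖s‖) ^ ℓ := by
      rw [Real.rpow_neg ht.le, ← Real.inv_rpow ht.le, ← Real.mul_rpow (by positivity) hw.le]
      gcongr
      rw [← div_eq_inv_mul, le_div_iff₀ ht]
      nlinarith [norm_nonneg s]
    have h4 : (1 + t * ‖s‖) ^ ℓ * ((1 + t * ‖s‖) ^ K)⁻¹ ≤ ((1 + t * ‖s‖) ^ 2)⁻¹ := by
      rw [← Real.rpow_natCast _ K, ← Real.rpow_neg hw.le, ← Real.rpow_add hw,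
        ← Real.rpow_natCast _ 2, ← Real.rpow_neg hw.le]
      refine Real.rpow_le_rpow_of_exponent_le (by nlinarith [norm_nonneg s]) ?_
      push_cast
      linarith
    have h5 : Real.exp (s.re * (y + t)) = Real.exp (s.re * y) * Real.exp (t * s.re) := by
      rw [← Real.exp_add]; ring_nf
    calc ‖g s‖ = ‖F s‖ * (t * Real.exp (s.re * y) * ‖laplace φ (t * s)‖) := by
          simp [hg, Complex.norm_exp, abs_of_pos ht]
      _ ≤ (A * (t ^ (-ℓ) * (1 + t * ‖s‖) ^ ℓ)) * (t * Real.exp (s.re * y) *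
          (2 ^ (K + 1) * M * Real.exp (t * s.re) / (1 + t * ‖s‖) ^ K)) := by
          gcongr
          exact h1.trans (by gcongr)
      _ = C * (Real.exp (s.re * y) * Real.exp (t * s.re)) *
          (t * ((1 + t * ‖s‖) ^ ℓ * ((1 + t * ‖s‖) ^ K)⁻¹)) := by
          rw [hC, div_eq_mul_inv]; ring
      _ ≤ _ := by rw [h5]; gcongr
  have hbound : ∀ ε : ℝ, 0 < ε →
      ‖∑' n, a n * φ ((lam n - y) / t)‖ ≤ C / 2 * Real.exp (ε * (y + t)) := by
    intro ε hε
    obtain ⟨c₀, hc₀⟩ := h.hasSum_perron_of_le hφ hs (y := y) ht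
    have hsum := (hc₀ (max c₀ ε) (le_max_left _ _)).tsum_eq
    -- The constant B only has to be finite to justify the shift; it does not enter the final
    -- estimate.
    have hshift := integral_line_eq_of_decay (g := g) hε (le_max_right c₀ ε) hgd
      (B := C * Real.exp (max c₀ ε * (|y| + t)) * (t * (t ^ 2)⁻¹)) fun s h1 h2 => by
        have hs0 := hε.trans_le h1
        refine (hgb s hs0).trans ?_
        have h3 : s.re * (y + t) ≤ max c₀ ε * (|y| + t) :=
          calc s.re * (y + t) ≤ s.re * (|y| + t) := by gcongr; exact le_abs_self y
            _ ≤ _ := by gcongr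
        have h4 : ((1 + t * ‖s‖) ^ 2)⁻¹ ≤ (t ^ 2)⁻¹ * ((1 + ‖s‖) ^ 2)⁻¹ := by
          rw [← mul_inv, ← mul_pow]
          gcongr
          nlinarith [norm_nonneg s]
        calc C * Real.exp (s.re * (y + t)) * (t * ((1 + t * ‖s‖) ^ 2)⁻¹)
            ≤ C * Real.exp (max c₀ ε * (|y| + t)) * (t * ((t ^ 2)⁻¹ * ((1 + ‖s‖) ^ 2)⁻¹)) := by
              gcongr
          _ = _ := by ring
    rw [show (∫ τ : ℝ, F ((max c₀ ε : ℝ) + τ * Complex.I) *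
        (t * Complex.exp (((max c₀ ε : ℝ) + τ * Complex.I) * y) *
          laplace φ (t * ((max c₀ ε : ℝ) + τ * Complex.I)))) =
        ∫ τ : ℝ, g (ε + τ * Complex.I) from hshift.symm, tsum_mul_left] at hsum
    -- The majorant t/(1+(tτ)²) has integral π whatever t is, so integration loses no further power
    -- of t.
    have hint : Integrable fun τ : ℝ => t * (1 + (t * τ) ^ 2)⁻¹ :=
      (integrable_inv_one_add_sq.comp_mul_left' ht.ne').const_mul t
    have hval : ∫ τ : ℝ, t * (1 + (t * τ) ^ 2)⁻¹ = Real.pi := by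
      rw [integral_const_mul, Measure.integral_comp_mul_left (fun x : ℝ => (1 + x ^ 2)⁻¹),
        integral_univ_inv_one_add_sq, abs_of_pos (by positivity), smul_eq_mul,
        mul_inv_cancel_left₀ ht.ne']
    have hle := norm_integral_le_of_norm_le (f := fun τ : ℝ => g (ε + τ * Complex.I))
      (hint.const_mul (C * Real.exp (ε * (y + t)))) (Eventually.of_forall fun τ => by
        have hre : ((ε : ℂ) + τ * Complex.I).re = ε := by simp
        have h1 := hgb (ε + τ * Complex.I) (by rw [hre]; exact hε)
        rw [hre] at h1
        refine h1.trans ?_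
        gcongr
        have him : |τ| ≤ ‖(ε : ℂ) + τ * Complex.I‖ := by
          simpa using Complex.abs_im_le_norm ((ε : ℂ) + τ * Complex.I)
        have h2 : t * |τ| ≤ t * ‖(ε : ℂ) + τ * Complex.I‖ := by gcongr
        have h3 : (t * τ) ^ 2 = (t * |τ|) ^ 2 := by rw [mul_pow, mul_pow, sq_abs]
        rw [h3]
        have h4 : 0 ≤ t * |τ| := by positivity
        nlinarith)
    rw [integral_const_mul, hval, ← hsum, norm_mul] at hle
    have h2pi : ‖(2 * Real.pi : ℂ)‖ = 2 * Real.pi := by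
      simp [abs_of_pos Real.pi_pos]
    rw [h2pi] at hle
    nlinarith [Real.pi_pos]
  -- Letting ε → 0 removes e^{ε(y+t)}, which makes the estimate uniform in y.
  have hlim : Tendsto (fun ε : ℝ => C / 2 * Real.exp (ε * (y + t))) (𝓝[>] 0) (𝓝 (C / 2)) := by
    have : Continuous fun ε : ℝ => C / 2 * Real.exp (ε * (y + t)) := by fun_prop
    simpa using this.continuousWithinAt (s := Ioi 0) (x := 0) |>.tendsto
  have := ge_of_tendsto hlim (eventually_nhdsWithin_of_forall fun ε hε => hbound ε hε)
  refine this.trans (le_of_eq ?_)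
  rw [hC, pow_succ]
  ring

end HasDirichletExpansion

/-! ### Families of test functions -/

theorem contDiff_uncurry_iteratedDeriv {E : Type*} [NormedAddCommGroup E] [NormedSpace ℝ E]
    {Q : E → ℝ → ℂ} (hQ : ContDiff ℝ ∞ (Function.uncurry Q)) (K : ℕ) :
    ContDiff ℝ ∞ (Function.uncurry fun p => iteratedDeriv K (Q p)) := by
  induction K with
  | zero => simpa [iteratedDeriv_zero] using hQ
  | succ K ih =>
    have h : ContDiff ℝ ∞ fun x : E × ℝ => fderiv ℝ (iteratedDeriv K (Q x.1)) x.2 := by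
      refine ContDiff.fderiv (n := ∞) (m := ∞) (f := fun x : E × ℝ => iteratedDeriv K (Q x.1))
        (g := fun x => x.2) ?_ contDiff_snd (by simp)
      exact ih.comp ((contDiff_fst.comp contDiff_fst).prodMk contDiff_snd)
    convert h.clm_apply (contDiff_const (c := (1 : ℝ))) using 1
    ext x
    simp only [Function.uncurry, iteratedDeriv_succ]
    rfl

theorem exists_norm_le_of_contDiff_uncurry {E : Type*} [NormedAddCommGroup E] [NormedSpace ℝ E]
    {Q : E → ℝ → ℂ} (hQ : ContDiff ℝ ∞ (Function.uncurry Q)) {s : Set E} (hs : IsCompact s)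
    (hsupp : ∀ p ∈ s, Function.support (Q p) ⊆ Icc (-1) 1) (K : ℕ) :
    ∃ M : ℝ, 0 ≤ M ∧ ∀ p ∈ s, ∀ r, ‖iteratedDeriv K (Q p) r‖ ≤ M := by
  obtain ⟨M, hM⟩ := (hs.prod (isCompact_Icc (a := (-1 : ℝ)) (b := 1))).exists_bound_of_continuousOn
    (contDiff_uncurry_iteratedDeriv hQ K).continuous.continuousOn
  refine ⟨max M 0, le_max_right _ _, fun p hp r => ?_⟩
  by_cases hr : r ∈ Icc (-1 : ℝ) 1
  · exact (hM (p, r) ⟨hp, hr⟩).trans (le_max_left _ _)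
  · rw [Function.notMem_support.1 fun h =>
      hr (support_iteratedDeriv_subset_Icc (hsupp p hp) K h), norm_zero]
    exact le_max_right _ _

/-- The form in which the basic estimate is applied: one constant for all series, centres, widths
and parameters in a compact set. Joint smoothness bounds the required derivatives uniformly there.
-/
theorem exists_norm_tsum_family_le (lam : Frequency) {ℓ : ℝ} (hℓ : 0 ≤ ℓ) {E : Type*}
    [NormedAddCommGroup E] [NormedSpace ℝ E] {Q : E → ℝ → ℂ}
    (hQ : ContDiff ℝ ∞ (Function.uncurry Q)) {s : Set E} (hs : IsCompact s)
    (hsupp : ∀ p ∈ s, Function.support (Q p) ⊆ Icc (-1) 1) :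
    ∃ C : ℝ, 0 ≤ C ∧ ∀ (a : ℕ → ℂ) (F : ℂ → ℂ) (A : ℝ), HasDirichletExpansion lam ℓ a F A →
      ∀ p ∈ s, ∀ y t : ℝ, 0 < t → t ≤ 1 →
        ‖∑' n, a n * Q p ((lam n - y) / t)‖ ≤ C * A * t ^ (-ℓ) := by
  set K := ⌈ℓ⌉₊ + 2
  obtain ⟨M₀, hM₀, h₀⟩ := exists_norm_le_of_contDiff_uncurry hQ hs hsupp 0
  obtain ⟨M₁, -, h₁⟩ := exists_norm_le_of_contDiff_uncurry hQ hs hsupp K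
  refine ⟨2 ^ K * max M₀ M₁, mul_nonneg (by positivity) (le_max_of_le_left hM₀),
    fun a F A h p hp y t ht ht1 => ?_⟩
  have hK : ℓ + 2 ≤ (K : ℕ) := by
    have := Nat.le_ceil ℓ
    push_cast [K]
    linarith
  exact h.norm_tsum_le hℓ hK (hQ.comp (contDiff_prodMk_right p)) (hsupp p hp)
    (fun r => by simpa using (h₀ p hp r).trans (le_max_left _ _))
    (fun r => (h₁ p hp r).trans (le_max_right _ _)) y ht ht1

/-! ### Smooth partitions of unity and smoothly cut off powers -/

/-- A smooth bump on `[-1, 1]` whose translations by integers sum to `1`. -/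
def hat (t : ℝ) : ℝ := Real.smoothTransition (t + 1) - Real.smoothTransition t

theorem contDiff_hat : ContDiff ℝ ∞ hat := by
  have h : ContDiff ℝ ∞ Real.smoothTransition := Real.smoothTransition.contDiff
  exact (h.comp (contDiff_id.add contDiff_const)).sub h

theorem hat_zero : hat 0 = 1 := by simp [hat]

theorem hat_eq_zero {t : ℝ} (h : 1 ≤ |t|) : hat t = 0 := by
  rcases le_abs.1 h with h | h
  · simp [hat, Real.smoothTransition.one_of_one_le h,
      Real.smoothTransition.one_of_one_le (show 1 ≤ t + 1 by linarith)]
  · simp [hat, Real.smoothTransition.zero_of_nonpos (show t ≤ 0 by linarith),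
      Real.smoothTransition.zero_of_nonpos (show t + 1 ≤ 0 by linarith)]

theorem hat_nonneg (t : ℝ) : 0 ≤ hat t :=
  sub_nonneg.2 (Real.smoothTransition.monotone (by linarith))

theorem hat_le_one (t : ℝ) : hat t ≤ 1 := by
  have := Real.smoothTransition.le_one (t + 1)
  have := Real.smoothTransition.nonneg t
  unfold hat
  linarith

/-- The sum telescopes. For t ≥ 0 the first term on the right is 1, leaving a smooth cut-off that
descends from 1 to 0 on [N-1,N]. -/
theorem sum_range_hat (t : ℝ) (N : ℕ) : ∑ m ∈ Finset.range N, hat (t - m) =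
    Real.smoothTransition (t + 1) - Real.smoothTransition (t + 1 - N) := by
  induction N with
  | zero => simp
  | succ N ih =>
    rw [Finset.sum_range_succ, ih, hat]
    push_cast
    rw [show t + 1 - ((N : ℝ) + 1) = t - N by ring, show t - (N : ℝ) + 1 = t + 1 - N by ring]
    ring

theorem support_subset_Icc_of_hat {φ : ℝ → ℂ} (h : ∀ r, hat r = 0 → φ r = 0) :
    Function.support φ ⊆ Icc (-1) 1 := by
  intro r hr
  by_contra hn
  refine hr (h r (hat_eq_zero ?_))
  rw [mem_Icc, ← abs_le, not_le] at hn
  exact hn.le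

/-- The power `v ^ ℓ`, smoothly cut off between `1 / 2` and `1`. -/
def powStep (ℓ v : ℝ) : ℝ := v ^ ℓ * Real.smoothTransition (2 * v - 1)

theorem powStep_of_le {ℓ v : ℝ} (h : v ≤ 1 / 2) : powStep ℓ v = 0 := by
  rw [powStep, Real.smoothTransition.zero_of_nonpos (by linarith), mul_zero]

theorem powStep_of_ge {ℓ v : ℝ} (h : 1 ≤ v) : powStep ℓ v = v ^ ℓ := by
  rw [powStep, Real.smoothTransition.one_of_one_le (by linarith), mul_one]

theorem contDiff_powStep (ℓ : ℝ) : ContDiff ℝ ∞ (powStep ℓ) := by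
  rw [contDiff_iff_contDiffAt]
  intro v
  rcases lt_or_ge v (1 / 2) with hv | hv
  · refine (contDiffAt_const (c := (0 : ℝ))).congr_of_eventuallyEq ?_
    filter_upwards [Iio_mem_nhds hv] with w hw
    exact powStep_of_le (le_of_lt hw)
  · have h : ContDiff ℝ ∞ Real.smoothTransition := Real.smoothTransition.contDiff
    exact (Real.contDiffAt_rpow_const_of_ne (by linarith)).mul
      (h.comp ((contDiff_const.mul contDiff_id).sub contDiff_const)).contDiffAt

/-- The dyadic piece of `v ^ ℓ` on `[1 / 4, 1]`. -/
def dyadicPow (ℓ v : ℝ) : ℝ := 2 ^ (-ℓ) * powStep ℓ (2 * v) - powStep ℓ v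

theorem contDiff_dyadicPow (ℓ : ℝ) : ContDiff ℝ ∞ (dyadicPow ℓ) := by
  have h := contDiff_powStep ℓ
  exact (contDiff_const.mul (h.comp (contDiff_const.mul contDiff_id))).sub h

theorem dyadicPow_of_le {ℓ v : ℝ} (h : v ≤ 0) : dyadicPow ℓ v = 0 := by
  rw [dyadicPow, powStep_of_le (by linarith), powStep_of_le (by linarith)]
  simp

/-- Both terms are pure powers there and cancel by homogeneity. Hence the pieces have compact
support although v^ℓ does not. -/
theorem dyadicPow_of_ge {ℓ v : ℝ} (h : 1 ≤ v) : dyadicPow ℓ v = 0 := by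
  rw [dyadicPow, powStep_of_ge (by linarith), powStep_of_ge h,
    Real.mul_rpow (by norm_num) (by linarith), ← mul_assoc, ← Real.rpow_add (by norm_num)]
  simp

/-- Telescoping: the j-th term moves the cut-off near v = 0 from scale 2^{-j} to scale 2^{-j-1}. -/
theorem powStep_add_sum_dyadicPow (ℓ v : ℝ) (J : ℕ) :
    powStep ℓ v + ∑ j ∈ Finset.range J, ((2 : ℝ) ^ j) ^ (-ℓ) * dyadicPow ℓ (2 ^ j * v) =
      ((2 : ℝ) ^ J) ^ (-ℓ) * powStep ℓ (2 ^ J * v) := by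
  induction J with
  | zero => simp
  | succ J ih =>
    rw [Finset.sum_range_succ, ← add_assoc, ih, dyadicPow, pow_succ,
      Real.mul_rpow (by positivity) (by norm_num), mul_sub, mul_comm ((2 : ℝ) ^ J) 2]
    ring_nf

/-! ### Bohr's condition -/

/-- The comparison function never vanishes, so the O-bound holds for every n with one constant.
Normalising c ≤ 1 lets the gap serve as a width t ≤ 1. -/
theorem BohrCondition.exists_gap {lam : Frequency} {β : ℝ} (h : BohrCondition lam β) :
    ∃ c : ℝ, 0 < c ∧ c ≤ 1 ∧ ∀ n, c * Real.exp (-(β * lam n)) ≤ lam (n + 1) - lam n := by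
  have hpos : ∀ n, 0 < lam (n + 1) - lam n := fun n => sub_pos.2 (lam.strictMono n.lt_succ_self)
  obtain ⟨C, hC⟩ := (Asymptotics.isBigO_nat_atTop_iff
    (fun n hn => absurd hn (Real.exp_pos _).ne')).1 h
  refine ⟨(max C 1)⁻¹, by positivity, inv_le_one_of_one_le₀ (le_max_right _ _), fun n => ?_⟩
  have h1 := hC n
  rw [Real.norm_of_nonneg (by have := hpos n; positivity), Real.norm_of_nonneg (by positivity),
    div_le_iff₀ (hpos n)] at h1
  rw [Real.exp_neg, ← mul_inv, inv_le_iff_one_le_mul₀' (by positivity)]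
  refine h1.trans ?_
  have := (hpos n).le
  gcongr
  exact le_max_left _ _

theorem gap_le_sub {lam : Frequency} {β c : ℝ} (hβ : 0 ≤ β) (hc : 0 ≤ c)
    (hgap : ∀ n, c * Real.exp (-(β * lam n)) ≤ lam (n + 1) - lam n) {k n : ℕ} (hkn : k < n)
    {x : ℝ} (hx : lam k ≤ x) : c * Real.exp (-(β * x)) ≤ lam n - lam k :=
  calc c * Real.exp (-(β * x)) ≤ c * Real.exp (-(β * lam k)) := by gcongr
    _ ≤ lam (k + 1) - lam k := hgap k
    _ ≤ _ := by gcongr; exact lam.strictMono.monotone hkn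

/-- A bump of width c e^{-βλ_n} centred at λ_n meets no other frequency, so the basic estimate
bounds a_n alone, and t^{-ℓ} becomes c^{-ℓ} e^{βℓλ_n}. -/
theorem exists_norm_coeff_le (lam : Frequency) {β : ℝ} (hβ : 0 ≤ β) (hBC : BohrCondition lam β)
    {ℓ : ℝ} (hℓ : 0 ≤ ℓ) : ∃ C : ℝ, 0 ≤ C ∧ ∀ (a : ℕ → ℂ) (F : ℂ → ℂ) (A : ℝ),
      HasDirichletExpansion lam ℓ a F A → ∀ n, ‖a n‖ ≤ C * A * Real.exp (β * ℓ * lam n) := by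
  obtain ⟨c, hc, hc1, hgap⟩ := hBC.exists_gap
  -- A single test function suffices here, so the family is constant with a dummy parameter.
  have hQ : ContDiff ℝ ∞ (Function.uncurry fun (_ : ℝ) (r : ℝ) => (hat r : ℂ)) :=
    Complex.ofRealCLM.contDiff.comp (contDiff_hat.comp contDiff_snd)
  obtain ⟨C, hC, h⟩ := exists_norm_tsum_family_le lam hℓ hQ (isCompact_singleton (x := 0))
    (fun _ _ => support_subset_Icc_of_hat fun r hr => by simp [hr])
  refine ⟨C * c ^ (-ℓ), by positivity, fun a F A hF n => ?_⟩
  have ht : 0 < c * Real.exp (-(β * lam n)) := by positivity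
  have ht1 : c * Real.exp (-(β * lam n)) ≤ 1 :=
    mul_le_one₀ hc1 (Real.exp_pos _).le
      (Real.exp_le_one_iff.2 (neg_nonpos.2 (mul_nonneg hβ (lam.nonneg n))))
  have h1 := h a F A hF 0 rfl (lam n) _ ht ht1
  rw [tsum_eq_single n] at h1
  · rw [sub_self, zero_div, hat_zero, Complex.ofReal_one, mul_one,
      Real.mul_rpow hc.le (Real.exp_pos _).le, ← Real.exp_mul] at h1
    refine h1.trans (le_of_eq ?_)
    ring_nf
  · intro k hk
    rw [hat_eq_zero, Complex.ofReal_zero, mul_zero]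
    rw [abs_div, abs_of_pos ht, le_div_iff₀ ht, one_mul]
    rcases lt_or_gt_of_ne hk with hk | hk
    · rw [abs_sub_comm]
      exact (gap_le_sub hβ hc.le hgap hk (lam.strictMono.monotone hk.le)).trans (le_abs_self _)
    · exact (gap_le_sub hβ hc.le hgap hk le_rfl).trans (le_abs_self _)

/-- The difference has growth constant 0, so the coefficient estimate makes all its coefficients
vanish. -/
theorem HasDirichletExpansion.coeff_unique {lam : Frequency} {β : ℝ} (hβ : 0 ≤ β)
    (hBC : BohrCondition lam β) {ℓ : ℝ} (hℓ : 0 ≤ ℓ) {a b : ℕ → ℂ} {F G : ℂ → ℂ} {A B : ℝ}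
    (ha : HasDirichletExpansion lam ℓ a F A) (hb : HasDirichletExpansion lam ℓ b G B)
    (hFG : ∀ s : ℂ, 0 < s.re → F s = G s) : a = b := by
  obtain ⟨C, -, hC⟩ := exists_norm_coeff_le lam hβ hBC hℓ
  have h := ha.sub hb
  have h0 : HasDirichletExpansion lam ℓ (a - b) (F - G) 0 :=
    ⟨h.differentiableOn, fun s hs => by simp [hFG s hs], h.series⟩
  funext n
  have := hC _ _ _ h0 n
  rw [mul_zero, zero_mul, norm_le_zero_iff, Pi.sub_apply] at this
  exact sub_eq_zero.1 this

/-- Each step increases e^{βλ_n} by at least e^{βλ_n}·β(λ_{n+1} - λ_n) ≥ βc, so it grows at least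
linearly. -/
theorem exists_pos_le_exp {lam : Frequency} {β : ℝ} (hβ : 0 < β) (hBC : BohrCondition lam β) :
    ∃ c : ℝ, 0 < c ∧ ∀ n : ℕ, c * (n + 1) ≤ Real.exp (β * lam n) := by
  obtain ⟨c, hc, hc1, hgap⟩ := hBC.exists_gap
  refine ⟨min 1 (β * c), by positivity, fun n => ?_⟩
  induction n with
  | zero =>
    have := Real.one_le_exp (mul_nonneg hβ.le (lam.nonneg 0))
    have := min_le_left 1 (β * c)
    push_cast
    linarith
  | succ n ih =>
    have h1 : Real.exp (β * lam (n + 1)) =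
        Real.exp (β * lam n) * Real.exp (β * (lam (n + 1) - lam n)) := by
      rw [← Real.exp_add]; ring_nf
    have h2 := Real.add_one_le_exp (β * (lam (n + 1) - lam n))
    have h3 : β * (c * Real.exp (-(β * lam n))) ≤ β * (lam (n + 1) - lam n) := by
      gcongr; exact hgap n
    have h4 : Real.exp (β * lam n) * (β * (c * Real.exp (-(β * lam n)))) = β * c := by
      rw [Real.exp_neg]; field_simp
    have h5 : Real.exp (β * lam n) * (1 + β * (c * Real.exp (-(β * lam n)))) ≤
        Real.exp (β * lam (n + 1)) := by
      rw [h1]; gcongr; linarith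
    have := min_le_right 1 (β * c)
    push_cast
    nlinarith

theorem summable_exp_neg_two_mul {lam : Frequency} {β : ℝ} (hβ : 0 < β)
    (hBC : BohrCondition lam β) : Summable fun n => Real.exp (-(2 * β * lam n)) := by
  obtain ⟨c, hc, h⟩ := exists_pos_le_exp hβ hBC
  have hs : Summable fun n : ℕ => (c ^ 2)⁻¹ * (((n + 1 : ℕ) : ℝ) ^ 2)⁻¹ :=
    ((summable_nat_add_iff 1).2 (Real.summable_nat_pow_inv.2 one_lt_two)).mul_left _
  refine Summable.of_nonneg_of_le (fun n => (Real.exp_pos _).le) (fun n => ?_) hs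
  have h1 : Real.exp (-(2 * β * lam n)) = ((Real.exp (β * lam n)) ^ 2)⁻¹ := by
    rw [← Real.exp_nat_mul, ← Real.exp_neg]
    congr 1
    push_cast
    ring
  rw [h1, ← mul_inv, ← mul_pow]
  have := h n
  push_cast
  gcongr

/-! ### Smooth decomposition of Dirichlet series -/

theorem Frequency.mem_below {lam : Frequency} {x : ℝ} {n : ℕ} : n ∈ lam.below x ↔ lam n < x := by
  simp [Frequency.below]

/-- The part of the Dirichlet series with frequencies near `m`. -/
def smoothBlock (lam : Frequency) (a : ℕ → ℂ) (m : ℕ) (s : ℂ) : ℂ :=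
  ∑ n ∈ lam.below (m + 1), a n * Complex.exp (-(lam n : ℂ) * s) * (hat (lam n - m) : ℂ)

theorem smoothBlock_translate (lam : Frequency) (a : ℕ → ℂ) (m : ℕ) (w s : ℂ) :
    smoothBlock lam (fun n => a n * Complex.exp (-(lam n : ℂ) * w)) m s =
      smoothBlock lam a m (w + s) := by
  refine Finset.sum_congr rfl fun n _ => ?_
  rw [mul_add, Complex.exp_add]
  ring

theorem hasSum_smoothBlock (lam : Frequency) (a : ℕ → ℂ) (m : ℕ) (s : ℂ) :
    HasSum (fun n => a n * Complex.exp (-(lam n : ℂ) * s) * (hat (lam n - m) : ℂ))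
      (smoothBlock lam a m s) := by
  refine hasSum_sum_of_ne_finset_zero fun n hn => ?_
  rw [Frequency.mem_below, not_lt] at hn
  rw [hat_eq_zero (le_trans (by linarith) (le_abs_self _)), Complex.ofReal_zero, mul_zero]

theorem differentiable_smoothBlock (lam : Frequency) (a : ℕ → ℂ) (m : ℕ) :
    Differentiable ℂ (smoothBlock lam a m) := by
  unfold smoothBlock
  fun_prop

/-- Basic estimate at width 1 centred at m. Splitting e^{-uλ} = e^{-um}e^{-u(λ-m)} extracts the
decay and leaves a fixed test function. -/
theorem exists_norm_smoothBlock_le_exp (lam : Frequency) {ℓ : ℝ} (hℓ : 0 ≤ ℓ) (u : ℝ) :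
    ∃ C : ℝ, 0 ≤ C ∧ ∀ (a : ℕ → ℂ) (F : ℂ → ℂ) (A : ℝ), HasDirichletExpansion lam ℓ a F A →
      ∀ m : ℕ, ‖smoothBlock lam a m u‖ ≤ C * A * Real.exp (-(u * m)) := by
  set Q : ℝ → ℝ → ℂ := fun _ r => (hat r : ℂ) * Complex.exp (-(u * r : ℝ)) with hQdef
  have hQ : ContDiff ℝ ∞ (Function.uncurry Q) := by
    refine ContDiff.mul (Complex.ofRealCLM.contDiff.comp (contDiff_hat.comp contDiff_snd)) ?_
    refine ContDiff.cexp ?_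
    exact (Complex.ofRealCLM.contDiff.comp (contDiff_const.mul contDiff_snd)).neg
  obtain ⟨C, hC, h⟩ := exists_norm_tsum_family_le lam hℓ hQ (isCompact_singleton (x := 0))
    (fun _ _ => support_subset_Icc_of_hat fun r hr => by simp [hQdef, hr])
  refine ⟨C, hC, fun a F A hF m => ?_⟩
  have h1 := h a F A hF 0 rfl m 1 one_pos le_rfl
  rw [Real.one_rpow, mul_one] at h1
  rw [← (hasSum_smoothBlock lam a m u).tsum_eq]
  have h2 : ∀ n, a n * Complex.exp (-(lam n : ℂ) * u) * (hat (lam n - m) : ℂ) =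
      Complex.exp (-(u * m : ℝ)) * (a n * Q 0 ((lam n - m) / 1)) := by
    intro n
    have : Complex.exp (-(lam n : ℂ) * u) =
        Complex.exp (-(u * m : ℝ)) * Complex.exp (-(u * (lam n - m) : ℝ)) := by
      rw [← Complex.exp_add]
      congr 1
      push_cast
      ring
    simp only [hQdef, div_one]
    rw [this]
    ring
  simp_rw [h2]
  rw [tsum_mul_left, norm_mul, mul_comm, Complex.norm_exp]
  simpa using mul_le_mul_of_nonneg_right h1 (Real.exp_pos (-(u * m))).le

theorem exists_norm_smoothBlock_le (lam : Frequency) {ℓ : ℝ} (hℓ : 0 ≤ ℓ) (u : ℝ) :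
    ∃ C : ℝ, 0 ≤ C ∧ ∀ (a : ℕ → ℂ) (F : ℂ → ℂ) (A : ℝ), HasDirichletExpansion lam ℓ a F A →
      ∀ (w : ℂ), 0 < w.re → ∀ m : ℕ,
        ‖smoothBlock lam a m (w + u)‖ ≤ C * (A * (1 + ‖w‖) ^ ℓ) * Real.exp (-(u * m)) := by
  obtain ⟨C, hC, h⟩ := exists_norm_smoothBlock_le_exp lam hℓ u
  refine ⟨C, hC, fun a F A hF w hw m => ?_⟩
  rw [← smoothBlock_translate]
  exact h _ _ _ (hF.translate hℓ hw) m

theorem summable_exp_neg_mul_nat {u : ℝ} (hu : 0 < u) :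
    Summable fun m : ℕ => Real.exp (-(u * m)) := by
  refine (Real.summable_exp_nat_mul_iff.2 (neg_neg_of_pos hu)).congr fun m => ?_
  ring_nf

namespace HasDirichletExpansion

variable {lam : Frequency} {ℓ : ℝ} {a : ℕ → ℂ} {F : ℂ → ℂ} {A : ℝ}

theorem summable_smoothBlock (h : HasDirichletExpansion lam ℓ a F A) (hℓ : 0 ≤ ℓ) {s : ℂ}
    (hs : 0 < s.re) : Summable fun m => smoothBlock lam a m s := by
  obtain ⟨C, -, hC⟩ := exists_norm_smoothBlock_le lam hℓ (s.re / 2)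
  have hC' := hC a F A h (s - (s.re / 2 : ℝ)) (by simp; linarith)
  refine Summable.of_norm_bounded ((summable_exp_neg_mul_nat (half_pos hs)).mul_left
    (C * (A * (1 + ‖s - (s.re / 2 : ℝ)‖) ^ ℓ))) fun m => ?_
  have := hC' m
  rwa [sub_add_cancel] at this

theorem tendsto_sum_smoothBlock {s : ℂ}
    (hs : Summable fun n => ‖a n * Complex.exp (-(lam n : ℂ) * s)‖) :
    Tendsto (fun N => ∑ m ∈ Finset.range N, smoothBlock lam a m s) atTop
      (𝓝 (∑' n, a n * Complex.exp (-(lam n : ℂ) * s))) := by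
  -- The partial sums of blocks are the full series multiplied by a smooth cut-off, which permits
  -- dominated convergence.
  have h1 : ∀ N : ℕ, ∑ m ∈ Finset.range N, smoothBlock lam a m s =
      ∑' n, a n * Complex.exp (-(lam n : ℂ) * s) *
        ((1 - Real.smoothTransition (lam n + 1 - N) : ℝ) : ℂ) := by
    intro N
    rw [← (hasSum_sum fun m _ => hasSum_smoothBlock lam a m s).tsum_eq]
    refine tsum_congr fun n => ?_
    rw [← Finset.mul_sum, ← Complex.ofReal_sum, sum_range_hat,
      Real.smoothTransition.one_of_one_le (by linarith [lam.nonneg n])]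
  simp_rw [h1]
  refine tendsto_tsum_of_dominated_convergence hs (fun n => ?_)
    (Eventually.of_forall fun N n => ?_)
  · refine tendsto_const_nhds.congr' ?_
    obtain ⟨N₀, hN₀⟩ := exists_nat_ge (lam n + 1)
    filter_upwards [eventually_ge_atTop N₀] with N hN
    have : (N₀ : ℝ) ≤ N := by exact_mod_cast hN
    rw [Real.smoothTransition.zero_of_nonpos (by linarith)]
    simp
  · rw [norm_mul]
    refine mul_le_of_le_one_right (norm_nonneg _) ?_
    rw [Complex.norm_real, Real.norm_eq_abs, abs_le]
    have := Real.smoothTransition.nonneg (lam n + 1 - N)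
    have := Real.smoothTransition.le_one (lam n + 1 - N)
    constructor <;> linarith

theorem summable_norm_of_le {c : ℝ} (hc : Summable fun n => ‖a n‖ * Real.exp (-(lam n * c)))
    {s : ℂ} (hs : c ≤ s.re) : Summable fun n => ‖a n * Complex.exp (-(lam n : ℂ) * s)‖ := by
  refine Summable.of_nonneg_of_le (fun n => norm_nonneg _) (fun n => ?_) hc
  rw [norm_mul, Complex.norm_exp]
  have := lam.nonneg n
  gcongr
  simp only [neg_mul, Complex.neg_re, Complex.re_ofReal_mul]
  gcongr

/-- The smooth blocks sum to the function on all of `[Re > 0]`. -/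
theorem hasSum_smoothBlock (h : HasDirichletExpansion lam ℓ a F A) (hℓ : 0 ≤ ℓ) {s : ℂ}
    (hs : 0 < s.re) : HasSum (fun m => smoothBlock lam a m s) (F s) := by
  obtain ⟨c, hc, hsum, hF⟩ := h.series
  have hA := h.nonneg
  -- With this u and R, the convex set V contains both s and the point c+1 of the absolute
  -- convergence region, and block bounds are uniform on V.
  set u : ℝ := min (s.re / 2) c with hu
  have hu0 : 0 < u := lt_min (half_pos hs) hc
  set R : ℝ := max ‖s‖ (c + 1) + 1 with hR
  set V : Set ℂ := {w : ℂ | u < w.re} ∩ Metric.ball 0 R with hV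
  have hVo : IsOpen V := (isOpen_lt continuous_const Complex.continuous_re).inter Metric.isOpen_ball
  have hVc : IsPreconnected V :=
    ((convex_halfSpace_re_gt u).inter (convex_ball 0 R)).isPreconnected
  obtain ⟨C, hC, hblock⟩ := exists_norm_smoothBlock_le lam hℓ u
  set G : ℂ → ℂ := fun w => ∑' m, smoothBlock lam a m w with hG
  have hGd : DifferentiableOn ℂ G V := by
    refine Complex.differentiableOn_tsum_of_summable_norm
      ((summable_exp_neg_mul_nat hu0).mul_left (C * (A * (1 + (R + u)) ^ ℓ)))
      (fun m => (differentiable_smoothBlock lam a m).differentiableOn) hVo fun m w hw => ?_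
    have h1 := hblock a F A h (w - u) (by have := hw.1; simp only [mem_ofPred_eq] at this; simp [this]) m
    rw [sub_add_cancel] at h1
    refine h1.trans ?_
    gcongr
    have h2 : ‖w‖ < R := by simpa using hw.2
    refine (norm_sub_le _ _).trans ?_
    rw [Complex.norm_real, Real.norm_of_nonneg hu0.le]
    linarith
  have hFd : DifferentiableOn ℂ F V :=
    h.differentiableOn.mono fun w hw => hu0.trans hw.1
  have hsV : s ∈ V := by
    refine ⟨(min_le_left _ _).trans_lt (half_lt_self hs), ?_⟩
    have := le_max_left ‖s‖ (c + 1)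
    simp only [Metric.mem_ball, dist_zero_right]
    linarith
  have hcV : ((c + 1 : ℝ) : ℂ) ∈ V := by
    refine ⟨?_, ?_⟩
    · have := min_le_right (s.re / 2) c
      simp only [mem_ofPred_eq, Complex.ofReal_re]
      linarith
    · have := le_max_right ‖s‖ (c + 1)
      simp only [Metric.mem_ball, dist_zero_right, Complex.norm_real, Real.norm_eq_abs]
      rw [abs_of_pos (by linarith)]
      linarith
  have hfar : ∀ w : ℂ, c ≤ w.re → G w = F w := by
    intro w hw
    have h1 := tendsto_sum_smoothBlock (summable_norm_of_le hsum hw)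
    rw [(hF w hw).tsum_eq] at h1
    exact tendsto_nhds_unique
      (h.summable_smoothBlock hℓ (hc.trans_le hw)).hasSum.tendsto_sum_nat h1
  -- Identity theorem: the block sum and F agree near c+1.
  have heq : EqOn G F V :=
    (hGd.analyticOnNhd hVo).eqOn_of_preconnected_of_eventuallyEq (hFd.analyticOnNhd hVo) hVc hcV (by
      have hn : {w : ℂ | c < w.re} ∈ 𝓝 ((c + 1 : ℝ) : ℂ) :=
        (isOpen_lt continuous_const Complex.continuous_re).mem_nhds (by simp)
      filter_upwards [hn] with w hw
      exact hfar w (le_of_lt hw))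
  rw [← heq hsV]
  exact (h.summable_smoothBlock hℓ hs).hasSum

end HasDirichletExpansion

/-! ### Riesz means of order `ℓ` -/

/-- D ranges over an unbounded set, but the basic estimate needs compact parameters. For D > 2
homogeneity gives (D-r)^ℓ = (D/2)^ℓ(2 - (2/D)r)^ℓ, and for D < -1 the function vanishes on |r| < 1.
-/
theorem exists_powStep_eq {ℓ x D : ℝ} (hℓ : 0 ≤ ℓ) (hx : 1 ≤ x) (hD : D ≤ x) :
    ∃ p ∈ Icc (-1 : ℝ) 2 ×ˢ Icc (0 : ℝ) 1, ∃ κ : ℝ, 0 ≤ κ ∧ κ ≤ x ^ ℓ ∧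
      ∀ r : ℝ, |r| < 1 → powStep ℓ (D - r) = κ * powStep ℓ (p.1 - p.2 * r) := by
  have hx1 : 1 ≤ x ^ ℓ := Real.one_le_rpow hx hℓ
  rcases lt_or_ge D (-1) with h1 | h1
  · refine ⟨(0, 0), by simp, 0, le_rfl, by positivity, fun r hr => ?_⟩
    rw [powStep_of_le (by linarith [(abs_lt.1 hr).1]), zero_mul]
  rcases le_or_gt D 2 with h2 | h2
  · exact ⟨(D, 1), by simp [h1, h2], 1, zero_le_one, hx1, fun r _ => by simp⟩
  · refine ⟨(2, 2 / D), ⟨by norm_num, by positivity, (div_le_one (by linarith)).2 h2.le⟩,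
      (D / 2) ^ ℓ, by positivity, Real.rpow_le_rpow (by linarith) (by linarith) hℓ, fun r hr => ?_⟩
    have hr' := abs_lt.1 hr
    have h3 : 2 / D * r ≤ 1 := by
      rw [div_mul_eq_mul_div, div_le_one (by linarith)]
      linarith [hr'.2]
    rw [powStep_of_ge (by linarith), powStep_of_ge (by dsimp only; linarith),
      ← Real.mul_rpow (by positivity) (by dsimp only; linarith)]
    congr 1
    dsimp only
    field_simp

/-- Provides the majorant, independent of x, for passing to the limit block by block. Normalising by
x^ℓ is enough because the scalar from `exists_powStep_eq` is at most x^ℓ. -/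
theorem exists_norm_sum_hat_powStep_le (lam : Frequency) {ℓ : ℝ} (hℓ : 0 ≤ ℓ) (u : ℝ) :
    ∃ C : ℝ, 0 ≤ C ∧ ∀ (a : ℕ → ℂ) (F : ℂ → ℂ) (A : ℝ), HasDirichletExpansion lam ℓ a F A →
      ∀ (m : ℕ) (x : ℝ), 1 ≤ x →
        ‖∑ n ∈ lam.below x, a n * Complex.exp (-(lam n : ℂ) * u) * (hat (lam n - m) : ℂ) *
          ((powStep ℓ (x - lam n) / x ^ ℓ : ℝ) : ℂ)‖ ≤ C * A * Real.exp (-(u * m)) := by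
  set Q : ℝ × ℝ → ℝ → ℂ := fun p r =>
    (hat r : ℂ) * Complex.exp (-(u * r : ℝ)) * (powStep ℓ (p.1 - p.2 * r) : ℂ) with hQdef
  have hQ : ContDiff ℝ ∞ (Function.uncurry Q) := by
    have hcoe : ContDiff ℝ ∞ fun r : ℝ => (r : ℂ) := Complex.ofRealCLM.contDiff
    refine ContDiff.mul (ContDiff.mul (hcoe.comp (contDiff_hat.comp contDiff_snd)) ?_) ?_
    · exact (hcoe.comp (contDiff_const.mul contDiff_snd)).neg.cexp
    · refine hcoe.comp ((contDiff_powStep ℓ).comp ?_)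
      exact (contDiff_fst.comp contDiff_fst).sub ((contDiff_snd.comp contDiff_fst).mul contDiff_snd)
  obtain ⟨C, hC, h⟩ := exists_norm_tsum_family_le lam hℓ hQ
    ((isCompact_Icc (a := (-1 : ℝ)) (b := 2)).prod (isCompact_Icc (a := (0 : ℝ)) (b := 1)))
    (fun _ _ => support_subset_Icc_of_hat fun r hr => by simp [hQdef, hr])
  refine ⟨C, hC, fun a F A hF m x hx => ?_⟩
  have hA := hF.nonneg
  obtain ⟨p, hp, κ, hκ, hκx, hκr⟩ := exists_powStep_eq hℓ hx
    (show x - m ≤ x by linarith [(Nat.cast_nonneg m : (0 : ℝ) ≤ m)])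
  have h1 := h a F A hF p hp m 1 one_pos le_rfl
  rw [Real.one_rpow, mul_one] at h1
  have h2 : ∀ n, a n * Complex.exp (-(lam n : ℂ) * u) * (hat (lam n - m) : ℂ) *
      ((powStep ℓ (x - lam n) / x ^ ℓ : ℝ) : ℂ) =
      (κ / x ^ ℓ * Real.exp (-(u * m)) : ℝ) * (a n * Q p ((lam n - m) / 1)) := by
    intro n
    by_cases hn : |lam n - m| < 1
    · have h3 := hκr _ hn
      rw [show x - m - (lam n - m) = x - lam n by ring] at h3
      have h4 : Complex.exp (-(lam n : ℂ) * u) =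
          Complex.exp (-(u * m : ℝ)) * Complex.exp (-(u * (lam n - m) : ℝ)) := by
        rw [← Complex.exp_add]
        congr 1
        push_cast
        ring
      simp only [hQdef, div_one]
      rw [h3, h4]
      push_cast
      ring
    · simp [hQdef, hat_eq_zero (not_lt.1 hn)]
  have hxℓ : 0 < x ^ ℓ := by positivity
  rw [← tsum_eq_sum (L := SummationFilter.unconditional ℕ) (s := lam.below x) fun n hn => by
    rw [Frequency.mem_below, not_lt] at hn
    rw [powStep_of_le (by linarith)]
    simp]
  simp_rw [h2]
  rw [tsum_mul_left, norm_mul, Complex.norm_real, Real.norm_of_nonneg (by positivity)]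
  calc κ / x ^ ℓ * Real.exp (-(u * m)) * ‖∑' n, a n * Q p ((lam n - m) / 1)‖
      ≤ 1 * Real.exp (-(u * m)) * (C * A) := by
        gcongr
        exact (div_le_one hxℓ).2 hκx
    _ = _ := by ring

theorem tendsto_sub_div_rpow (t ℓ : ℝ) :
    Tendsto (fun x : ℝ => (1 - t / x) ^ ℓ) atTop (𝓝 1) := by
  have h1 : Tendsto (fun x : ℝ => 1 - t / x) atTop (𝓝 1) := by
    simpa using (tendsto_const_nhds (x := (1 : ℝ))).sub
      ((tendsto_const_nhds (x := t)).div_atTop tendsto_id)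
  simpa using h1.rpow_const (p := ℓ) (Or.inl one_ne_zero)

/-- Once the weight is cut off smoothly within distance 1 of x, no fine scale is involved: each
block converges to the unweighted one and the majorants e^{-um} are summable. -/
theorem HasDirichletExpansion.tendsto_sum_powStep {lam : Frequency} {ℓ : ℝ} {a : ℕ → ℂ}
    {F : ℂ → ℂ} {A : ℝ} (h : HasDirichletExpansion lam ℓ a F A) (hℓ : 0 ≤ ℓ) {u : ℝ}
    (hu : 0 < u) :
    Tendsto (fun x : ℝ => ∑ n ∈ lam.below x, a n * Complex.exp (-(lam n : ℂ) * u) *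
      ((powStep ℓ (x - lam n) / x ^ ℓ : ℝ) : ℂ)) atTop (𝓝 (F u)) := by
  obtain ⟨C, hC, hb⟩ := exists_norm_sum_hat_powStep_le lam hℓ u
  set T : ℝ → ℕ → ℂ := fun x m => ∑ n ∈ lam.below x, a n * Complex.exp (-(lam n : ℂ) * u) *
    (hat (lam n - m) : ℂ) * ((powStep ℓ (x - lam n) / x ^ ℓ : ℝ) : ℂ) with hT
  have hsum : ∀ x, ∑' m, T x m = ∑ n ∈ lam.below x, a n * Complex.exp (-(lam n : ℂ) * u) *
      ((powStep ℓ (x - lam n) / x ^ ℓ : ℝ) : ℂ) := by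
    intro x
    -- Blocks with m ≥ x+1 contain no frequency below x.
    obtain ⟨N, hN⟩ := exists_nat_ge (x + 1)
    rw [tsum_eq_sum (s := Finset.range N), hT]
    · simp only
      rw [Finset.sum_comm]
      refine Finset.sum_congr rfl fun n hn => ?_
      rw [Frequency.mem_below] at hn
      rw [← Finset.sum_mul, ← Finset.mul_sum, ← Complex.ofReal_sum, sum_range_hat,
        Real.smoothTransition.one_of_one_le (by linarith [lam.nonneg n]),
        Real.smoothTransition.zero_of_nonpos (by linarith)]
      simp
    · intro m hm
      refine Finset.sum_eq_zero fun n hn => ?_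
      rw [Frequency.mem_below] at hn
      have : (N : ℝ) ≤ m := by simpa using hm
      rw [hat_eq_zero (le_trans (by linarith) (neg_le_abs _))]
      simp
  rw [← (h.hasSum_smoothBlock hℓ (s := u) (by simpa using hu)).tsum_eq]
  simp_rw [← hsum]
  refine tendsto_tsum_of_dominated_convergence
    ((summable_exp_neg_mul_nat hu).mul_left (C * A)) (fun m => ?_) ?_
  · have hlim : Tendsto (fun x : ℝ => ∑ n ∈ lam.below (m + 1),
        a n * Complex.exp (-(lam n : ℂ) * u) * (hat (lam n - m) : ℂ) *
          (((1 - lam n / x) ^ ℓ : ℝ) : ℂ)) atTop (𝓝 (smoothBlock lam a m u)) := by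
      refine tendsto_finsetSum _ fun n _ => ?_
      have := (Complex.continuous_ofReal.tendsto _).comp (tendsto_sub_div_rpow (lam n) ℓ)
      simpa using this.const_mul (a n * Complex.exp (-(lam n : ℂ) * u) * (hat (lam n - m) : ℂ))
    refine hlim.congr' ?_
    -- The block lives on λ < m+1, so now x - λ ≥ 1 and the cut-off is inactive.
    filter_upwards [eventually_ge_atTop ((m : ℝ) + 2)] with x hx
    have hsub : lam.below (m + 1) ⊆ lam.below x := fun n hn => by
      rw [Frequency.mem_below] at hn ⊢
      linarith
    rw [hT]
    simp only
    rw [← Finset.sum_subset hsub]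
    · refine Finset.sum_congr rfl fun n hn => ?_
      rw [Frequency.mem_below] at hn
      have hx0 : 0 < x := by linarith [(Nat.cast_nonneg m : (0 : ℝ) ≤ m)]
      rw [powStep_of_ge (by linarith), ← Real.div_rpow (by linarith) hx0.le, sub_div,
        div_self hx0.ne']
    · intro n _ hn
      rw [Frequency.mem_below, not_lt] at hn
      rw [hat_eq_zero (le_trans (by linarith) (le_abs_self _))]
      simp
  · filter_upwards [eventually_ge_atTop 1] with x hx m
    exact hb a F A h m x hx

/-- Basic estimate at width 2^{-j} centred at x. The height 2^{-jℓ} of the piece cancels the loss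
2^{jℓ}: this is where the order of the Riesz mean meets the growth exponent. -/
theorem exists_norm_sum_dyadicPow_le (lam : Frequency) {ℓ : ℝ} (hℓ : 0 ≤ ℓ) (u : ℝ) :
    ∃ C : ℝ, 0 ≤ C ∧ ∀ (a : ℕ → ℂ) (F : ℂ → ℂ) (A : ℝ), HasDirichletExpansion lam ℓ a F A →
      ∀ (j : ℕ) (x : ℝ), ‖∑ n ∈ lam.below x, a n * Complex.exp (-(lam n : ℂ) * u) *
        (((2 ^ j) ^ (-ℓ) * dyadicPow ℓ (2 ^ j * (x - lam n)) : ℝ) : ℂ)‖ ≤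
          C * A * Real.exp (-(u * x)) := by
  -- The parameter p stands for 2^{-j}; rescaling turns e^{-u(λ-x)} into e^{-upr} with p in the
  -- compact set [0,1].
  set Q : ℝ → ℝ → ℂ := fun p r =>
    (dyadicPow ℓ (-r) : ℂ) * Complex.exp (-(u * (p * r) : ℝ)) with hQdef
  have hQ : ContDiff ℝ ∞ (Function.uncurry Q) := by
    have hcoe : ContDiff ℝ ∞ fun r : ℝ => (r : ℂ) := Complex.ofRealCLM.contDiff
    refine ContDiff.mul (hcoe.comp ((contDiff_dyadicPow ℓ).comp contDiff_snd.neg)) ?_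
    exact (hcoe.comp (contDiff_const.mul (contDiff_fst.mul contDiff_snd))).neg.cexp
  obtain ⟨C, hC, h⟩ := exists_norm_tsum_family_le lam hℓ hQ
    (isCompact_Icc (a := (0 : ℝ)) (b := 1)) (fun p _ r hr => by
      by_contra hn
      refine hr ?_
      rw [mem_Icc, not_and_or, not_le, not_le] at hn
      simp only [hQdef]
      rcases hn with hn | hn
      · rw [dyadicPow_of_ge (by linarith)]; simp
      · rw [dyadicPow_of_le (by linarith)]; simp)
  refine ⟨C, hC, fun a F A hF j x => ?_⟩
  have h2j : (0 : ℝ) < 2 ^ j := by positivity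
  have ht1 : ((2 : ℝ) ^ j)⁻¹ ≤ 1 := inv_le_one_of_one_le₀ (one_le_pow₀ one_le_two)
  have h1 := h a F A hF ((2 : ℝ) ^ j)⁻¹ ⟨by positivity, ht1⟩ x _ (by positivity) ht1
  have h2 : ∀ n, a n * Complex.exp (-(lam n : ℂ) * u) *
      (((2 ^ j) ^ (-ℓ) * dyadicPow ℓ (2 ^ j * (x - lam n)) : ℝ) : ℂ) =
      ((2 ^ j) ^ (-ℓ) * Real.exp (-(u * x)) : ℝ) *
        (a n * Q ((2 : ℝ) ^ j)⁻¹ ((lam n - x) / ((2 : ℝ) ^ j)⁻¹)) := by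
    intro n
    have h4 : Complex.exp (-(lam n : ℂ) * u) =
        Complex.exp (-(u * x : ℝ)) * Complex.exp (-(u * (lam n - x) : ℝ)) := by
      rw [← Complex.exp_add]
      congr 1
      push_cast
      ring
    simp only [hQdef, div_inv_eq_mul]
    rw [h4, show -((lam n - x) * (2 : ℝ) ^ j) = 2 ^ j * (x - lam n) by ring,
      show ((2 : ℝ) ^ j)⁻¹ * ((lam n - x) * 2 ^ j) = lam n - x by field_simp]
    push_cast
    ring
  rw [← tsum_eq_sum (L := SummationFilter.unconditional ℕ) (s := lam.below x) fun n hn => by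
    rw [Frequency.mem_below, not_lt] at hn
    rw [dyadicPow_of_le (mul_nonpos_of_nonneg_of_nonpos h2j.le (by linarith))]
    simp]
  simp_rw [h2]
  rw [tsum_mul_left, norm_mul, Complex.norm_real, Real.norm_of_nonneg (by positivity)]
  calc (2 ^ j) ^ (-ℓ) * Real.exp (-(u * x)) *
        ‖∑' n, a n * Q ((2 : ℝ) ^ j)⁻¹ ((lam n - x) / ((2 : ℝ) ^ j)⁻¹)‖
      ≤ (2 ^ j) ^ (-ℓ) * Real.exp (-(u * x)) * (C * A * ((2 ^ j)⁻¹) ^ (-ℓ)) := by gcongr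
    _ = ((2 ^ j) ^ (-ℓ) * ((2 ^ j)⁻¹) ^ (-ℓ)) * (C * A * Real.exp (-(u * x))) := by ring
    _ = C * A * Real.exp (-(u * x)) := by
      rw [← Real.mul_rpow h2j.le (by positivity), mul_inv_cancel₀ h2j.ne', Real.one_rpow, one_mul]

theorem scaled_powStep_eq {ℓ v : ℝ} (hv : 0 ≤ v) (J : ℕ) :
    ((2 : ℝ) ^ J) ^ (-ℓ) * powStep ℓ (2 ^ J * v) =
      v ^ ℓ * Real.smoothTransition (2 * (2 ^ J * v) - 1) := by
  have h : (0 : ℝ) < 2 ^ J := by positivity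
  rw [powStep, Real.mul_rpow h.le hv, ← mul_assoc, ← mul_assoc, ← Real.rpow_add h]
  simp

/-- The remaining weight lives within 2^{-J} of x, less than the gap between frequencies below x, so
at most one frequency contributes. There the weight is at most e^{-βℓx}, which balances the
coefficient growth e^{βℓx}. -/
theorem norm_sum_remainder_le {lam : Frequency} {β ℓ c u B x : ℝ} {a : ℕ → ℂ} (hβ : 0 ≤ β)
    (hℓ : 0 ≤ ℓ) (hu : 0 ≤ u) (hc : 0 ≤ c) (hc1 : c ≤ 1) (hB : 0 ≤ B) {J : ℕ}
    (hgap : ∀ n, c * Real.exp (-(β * lam n)) ≤ lam (n + 1) - lam n)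
    (hJ : ((2 : ℝ) ^ J)⁻¹ ≤ c * Real.exp (-(β * x)))
    (ha : ∀ n, ‖a n‖ ≤ B * Real.exp (β * ℓ * lam n)) :
    ‖∑ n ∈ lam.below x, a n * Complex.exp (-(lam n : ℂ) * u) * (((x - lam n) ^ ℓ -
      (2 ^ J) ^ (-ℓ) * powStep ℓ (2 ^ J * (x - lam n)) : ℝ) : ℂ)‖ ≤
        B * Real.exp u * Real.exp (-(u * x)) := by
  have h2J : (0 : ℝ) < 2 ^ J := by positivity
  have hJ1 : ((2 : ℝ) ^ J)⁻¹ ≤ 1 := inv_le_one_of_one_le₀ (one_le_pow₀ one_le_two)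
  have hzero : ∀ n ∈ lam.below x, ((2 : ℝ) ^ J)⁻¹ ≤ x - lam n → (x - lam n) ^ ℓ -
      (2 ^ J) ^ (-ℓ) * powStep ℓ (2 ^ J * (x - lam n)) = 0 := by
    intro n hn hle
    rw [Frequency.mem_below] at hn
    have : 1 ≤ 2 ^ J * (x - lam n) := by
      rw [inv_le_iff_one_le_mul₀' h2J] at hle
      exact hle
    rw [scaled_powStep_eq (by linarith), Real.smoothTransition.one_of_one_le (by linarith)]
    simp
  by_cases hex : ∃ N ∈ lam.below x, x - lam N < ((2 : ℝ) ^ J)⁻¹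
  · obtain ⟨N, hN, hlt⟩ := hex
    have hN' := Frequency.mem_below.1 hN
    rw [Finset.sum_eq_single_of_mem N hN]
    · have h1 : 0 ≤ Real.smoothTransition (2 * (2 ^ J * (x - lam N)) - 1) :=
        Real.smoothTransition.nonneg _
      have h2 := Real.smoothTransition.le_one (2 * (2 ^ J * (x - lam N)) - 1)
      have h3 : (x - lam N) ^ ℓ ≤ Real.exp (-(β * x * ℓ)) := by
        rw [← neg_mul, Real.exp_mul]
        refine Real.rpow_le_rpow (by linarith) (hlt.le.trans (hJ.trans ?_)) hℓ
        exact mul_le_of_le_one_left (Real.exp_pos _).le hc1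
      have h4 : 0 ≤ (x - lam N) ^ ℓ := Real.rpow_nonneg (by linarith) _
      rw [scaled_powStep_eq (by linarith), ← mul_one_sub, norm_mul, norm_mul, Complex.norm_exp,
        Complex.norm_real, Real.norm_of_nonneg (mul_nonneg h4 (by linarith))]
      -- The surviving frequency exceeds x-1; this accounts for the factor e^u.
      have h5 : (-(lam N : ℂ) * u).re ≤ u - u * x := by
        simp only [neg_mul, Complex.neg_re, Complex.re_ofReal_mul, Complex.ofReal_re]
        nlinarith
      calc ‖a N‖ * Real.exp (-(lam N : ℂ) * u).re *
            ((x - lam N) ^ ℓ * (1 - Real.smoothTransition (2 * (2 ^ J * (x - lam N)) - 1)))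
          ≤ (B * Real.exp (β * ℓ * x)) * Real.exp (u - u * x) *
            (Real.exp (-(β * x * ℓ)) * 1) := by
            have := ha N
            gcongr
            · refine this.trans ?_
              gcongr
            · linarith
        _ = B * (Real.exp (β * ℓ * x) * Real.exp (-(β * x * ℓ))) * Real.exp (u - u * x) := by ring
        _ = _ := by
            rw [← Real.exp_add, show β * ℓ * x + -(β * x * ℓ) = 0 by ring, Real.exp_zero, mul_one,
              sub_eq_add_neg, Real.exp_add, mul_assoc]
    · intro n hn hne
      rw [hzero n hn, Complex.ofReal_zero, mul_zero]
      have hn' := Frequency.mem_below.1 hn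
      by_contra! hlt'
      rcases lt_or_gt_of_ne hne with hk | hk
      · linarith [gap_le_sub hβ hc hgap hk hn'.le]
      · linarith [gap_le_sub hβ hc hgap hk hN'.le]
  · push Not at hex
    rw [Finset.sum_eq_zero fun n hn => by rw [hzero n hn (hex n hn), Complex.ofReal_zero, mul_zero],
      norm_zero]
    positivity

theorem HasDirichletExpansion.rieszSummableTo_ofReal {lam : Frequency} {ℓ : ℝ≥0} {β : ℝ}
    (hβ : 0 ≤ β) (hBC : BohrCondition lam β) {a : ℕ → ℂ} {F : ℂ → ℂ} {A : ℝ}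
    (h : HasDirichletExpansion lam ℓ a F A) {u : ℝ} (hu : 0 < u) :
    RieszSummableTo lam ℓ a u (F u) := by
  have hℓ : (0 : ℝ) ≤ ℓ := ℓ.2
  have hA := h.nonneg
  obtain ⟨c, hc, hc1, hgap⟩ := hBC.exists_gap
  obtain ⟨C₁, hC₁, h₁⟩ := exists_norm_coeff_le lam hβ hBC hℓ
  obtain ⟨C₂, hC₂, h₂⟩ := exists_norm_sum_dyadicPow_le lam hℓ u
  set d : ℝ := -Real.log c with hd
  have hcd : c = Real.exp (-d) := by rw [hd, neg_neg, Real.exp_log hc]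
  have hd0 : 0 ≤ d := neg_nonneg.2 (Real.log_nonpos hc.le hc1)
  set E : ℝ → ℂ := fun x => ∑ n ∈ lam.below x, a n * Complex.exp (-(lam n : ℂ) * u) *
    (((x - lam n) ^ (ℓ : ℝ) - powStep ℓ (x - lam n) : ℝ) : ℂ) with hE
  have hEb : ∀ x : ℝ, 0 ≤ x → ‖E x‖ ≤
      ((2 * (β * x + d) + 1) * (C₂ * A) + C₁ * A * Real.exp u) * Real.exp (-(u * x)) := by
    intro x hx
    -- Since log 2 ≥ 1/2, this J makes 2^{-J} ≤ e^{-(βx+d)} = c e^{-βx}. That J grows only linearly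
    -- in x is harmless against e^{-ux}.
    set J : ℕ := ⌈2 * (β * x + d)⌉₊ with hJ
    have hJ0 : 0 ≤ β * x + d := by positivity
    have hJle : (J : ℝ) ≤ 2 * (β * x + d) + 1 := (Nat.ceil_lt_add_one (by positivity)).le
    have hJge : β * x + d ≤ Real.log 2 * J := by
      have h3 : 2 * (β * x + d) ≤ J := Nat.le_ceil _
      have h4 : (1 : ℝ) / 2 ≤ Real.log 2 := by linarith [Real.log_two_gt_d9]
      nlinarith
    have hJinv : ((2 : ℝ) ^ J)⁻¹ ≤ c * Real.exp (-(β * x)) := by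
      rw [hcd, ← Real.exp_add, ← Real.rpow_natCast, Real.rpow_def_of_pos two_pos, ← Real.exp_neg]
      exact Real.exp_le_exp.2 (by linarith)
    have hrem := norm_sum_remainder_le hβ hℓ hu.le hc.le hc1 (mul_nonneg hC₁ hA) hgap hJinv
      (h₁ a F A h)
    have hsplit : E x = ∑ j ∈ Finset.range J, ∑ n ∈ lam.below x,
        a n * Complex.exp (-(lam n : ℂ) * u) *
          (((2 ^ j) ^ (-(ℓ : ℝ)) * dyadicPow ℓ (2 ^ j * (x - lam n)) : ℝ) : ℂ) +
        ∑ n ∈ lam.below x, a n * Complex.exp (-(lam n : ℂ) * u) * (((x - lam n) ^ (ℓ : ℝ) -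
          (2 ^ J) ^ (-(ℓ : ℝ)) * powStep ℓ (2 ^ J * (x - lam n)) : ℝ) : ℂ) := by
      rw [Finset.sum_comm, ← Finset.sum_add_distrib]
      refine Finset.sum_congr rfl fun n _ => ?_
      rw [← Finset.mul_sum, ← mul_add, ← Complex.ofReal_sum, ← Complex.ofReal_add,
        ← powStep_add_sum_dyadicPow ℓ (x - lam n) J]
      congr 2
      ring
    rw [hsplit, add_mul]
    refine (norm_add_le _ _).trans (add_le_add ?_ hrem)
    refine (norm_sum_le_of_le _ fun j _ => h₂ a F A h j x).trans ?_
    rw [Finset.sum_const, Finset.card_range, nsmul_eq_mul, ← mul_assoc]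
    gcongr
  have hE0 : Tendsto E atTop (𝓝 0) := by
    have h0 : Tendsto (fun x : ℝ => Real.exp (-(u * x))) atTop (𝓝 0) := by
      refine Real.tendsto_exp_neg_atTop_nhds_zero.comp ?_
      exact tendsto_id.const_mul_atTop hu
    have h1 : Tendsto (fun x : ℝ => x * Real.exp (-(u * x))) atTop (𝓝 0) := by
      have := tendsto_rpow_mul_exp_neg_mul_atTop_nhds_zero 1 u hu
      simpa using this
    refine squeeze_zero_norm' (a := fun x => 2 * β * (C₂ * A) * (x * Real.exp (-(u * x))) +
      ((2 * d + 1) * (C₂ * A) + C₁ * A * Real.exp u) * Real.exp (-(u * x))) ?_ ?_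
    · filter_upwards [eventually_ge_atTop 0] with x hx
      refine (hEb x hx).trans (le_of_eq ?_)
      ring
    · simpa using (h1.const_mul (2 * β * (C₂ * A))).add
        (h0.const_mul ((2 * d + 1) * (C₂ * A) + C₁ * A * Real.exp u))
  have hE1 : Tendsto (fun x : ℝ => E x * (((x ^ (ℓ : ℝ))⁻¹ : ℝ) : ℂ)) atTop (𝓝 0) := by
    refine squeeze_zero_norm' ?_ (tendsto_zero_iff_norm_tendsto_zero.1 hE0)
    filter_upwards [eventually_ge_atTop 1] with x hx
    have hx1 : 1 ≤ x ^ (ℓ : ℝ) := Real.one_le_rpow hx hℓ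
    rw [norm_mul, Complex.norm_real, Real.norm_of_nonneg (by positivity)]
    exact mul_le_of_le_one_right (norm_nonneg _) (inv_le_one_of_one_le₀ hx1)
  have hsum := (h.tendsto_sum_powStep hℓ hu).add hE1
  rw [add_zero] at hsum
  refine hsum.congr' ?_
  filter_upwards [eventually_gt_atTop 0] with x hx
  rw [rieszMean, hE]
  simp only
  rw [Finset.sum_mul, ← Finset.sum_add_distrib]
  refine Finset.sum_congr rfl fun n hn => ?_
  rw [Frequency.mem_below] at hn
  rw [mul_assoc, mul_assoc, mul_assoc, ← mul_add, ← mul_add, mul_assoc]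
  congr 2
  rw [← Complex.ofReal_mul, ← Complex.ofReal_add, one_sub_div hx.ne',
    Real.div_rpow (by linarith) hx.le]
  congr 1
  field_simp
  ring

/-- Translating by s - Re(s)/2 moves s to the real point Re(s)/2. -/
theorem HasDirichletExpansion.rieszSummableTo {lam : Frequency} {ℓ : ℝ≥0} {β : ℝ}
    (hβ : 0 ≤ β) (hBC : BohrCondition lam β) {a : ℕ → ℂ} {F : ℂ → ℂ} {A : ℝ}
    (h : HasDirichletExpansion lam ℓ a F A) {s : ℂ} (hs : 0 < s.re) :
    RieszSummableTo lam ℓ a s (F s) := by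
  have hw : 0 < (s - (s.re / 2 : ℝ)).re := by simp; linarith
  have h1 := (h.translate ℓ.2 hw).rieszSummableTo_ofReal hβ hBC (half_pos hs)
  rw [sub_add_cancel] at h1
  refine h1.congr fun x => Finset.sum_congr rfl fun n _ => ?_
  rw [mul_assoc (a n), ← Complex.exp_add]
  congr 3
  ring

/-! ### Coefficients of Riesz summable Dirichlet series -/

theorem integral_rpow_mul_rpow_pos {m q : ℝ} (hm : 0 ≤ m) (hq : 0 ≤ q) :
    0 < ∫ v in (0 : ℝ)..1, v ^ m * (1 - v) ^ q := by
  have hc : Continuous fun v : ℝ => v ^ m * (1 - v) ^ q :=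
    (continuous_id.rpow_const fun _ => Or.inr hm).mul
      ((continuous_const.sub continuous_id).rpow_const fun _ => Or.inr hq)
  refine intervalIntegral.intervalIntegral_pos_of_pos_on (hc.intervalIntegrable _ _)
    (fun v hv => ?_) one_pos
  have := sub_pos.2 hv.2
  have := hv.1
  positivity

theorem integral_sub_rpow_mul_sub_rpow {m q t x : ℝ} (htx : t < x) :
    ∫ u in t..x, (u - t) ^ m * (x - u) ^ q =
      (x - t) ^ (m + q + 1) * ∫ v in (0 : ℝ)..1, v ^ m * (1 - v) ^ q := by
  have hL : 0 < x - t := sub_pos.2 htx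
  have h1 := intervalIntegral.integral_comp_mul_add (a := 0) (b := 1)
    (fun u : ℝ => (u - t) ^ m * (x - u) ^ q) hL.ne' t
  simp only [mul_zero, zero_add, mul_one, sub_add_cancel, add_sub_cancel_right] at h1
  rw [smul_eq_mul, eq_inv_mul_iff_mul_eq₀ hL.ne'] at h1
  rw [← h1, ← intervalIntegral.integral_const_mul, ← intervalIntegral.integral_const_mul]
  refine intervalIntegral.integral_congr fun v hv => ?_
  rw [uIcc_of_le zero_le_one] at hv
  rw [show x - ((x - t) * v + t) = (x - t) * (1 - v) by ring, Real.mul_rpow hL.le hv.1,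
    Real.mul_rpow hL.le (sub_nonneg.2 hv.2), Real.rpow_add hL, Real.rpow_add hL, Real.rpow_one]
  ring

/-- Riesz's formula: integrating sums of order m against (x-u)^q raises the order to m+q+1, up to a
Beta integral. It serves to reach an integer order. -/
theorem integral_sum_below_mul_rpow (lam : Frequency) (b : ℕ → ℂ) {m q x : ℝ} (hm : 0 ≤ m)
    (hq : 0 ≤ q) :
    ∫ u in Ioc 0 x, (∑ n ∈ lam.below u, b n * (((u - lam n) ^ m : ℝ) : ℂ)) *
        (((x - u) ^ q : ℝ) : ℂ) =
      ((∫ v in (0 : ℝ)..1, v ^ m * (1 - v) ^ q : ℝ) : ℂ) *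
        ∑ n ∈ lam.below x, b n * (((x - lam n) ^ (m + q + 1) : ℝ) : ℂ) := by
  have hc : ∀ t : ℝ, Continuous fun u : ℝ => (u - t) ^ m * (x - u) ^ q := fun t =>
    ((continuous_id.sub continuous_const).rpow_const fun _ => Or.inr hm).mul
      ((continuous_const.sub continuous_id).rpow_const fun _ => Or.inr hq)
  set g : ℕ → ℝ → ℂ := fun n =>
    (Ioi (lam n)).indicator fun u => b n * (((u - lam n) ^ m * (x - u) ^ q : ℝ) : ℂ) with hg
  have h1 : ∀ u ∈ Ioc 0 x, (∑ n ∈ lam.below u, b n * (((u - lam n) ^ m : ℝ) : ℂ)) *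
      (((x - u) ^ q : ℝ) : ℂ) = ∑ n ∈ lam.below x, g n u := by
    intro u hu
    have hsub : lam.below u ⊆ lam.below x := fun n hn =>
      Frequency.mem_below.2 ((Frequency.mem_below.1 hn).trans_le hu.2)
    rw [Finset.sum_mul, ← Finset.sum_subset hsub]
    · refine Finset.sum_congr rfl fun n hn => ?_
      rw [hg]
      simp only
      rw [indicator_of_mem (mem_Ioi.2 (Frequency.mem_below.1 hn))]
      push_cast
      ring
    · intro n _ hn
      rw [Frequency.mem_below] at hn
      exact indicator_of_notMem (by simpa using hn) _
  rw [setIntegral_congr_fun measurableSet_Ioc h1, integral_finsetSum, Finset.mul_sum]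
  · refine Finset.sum_congr rfl fun n hn => ?_
    have hn' := Frequency.mem_below.1 hn
    rw [hg, setIntegral_indicator measurableSet_Ioi, Ioc_inter_Ioi, max_eq_right (lam.nonneg n),
      integral_const_mul, integral_complex_ofReal, ← intervalIntegral.integral_of_le hn'.le,
      integral_sub_rpow_mul_sub_rpow hn']
    push_cast
    ring
  · intro n _
    refine IntegrableOn.indicator ?_ measurableSet_Ioi
    have := hc (lam n)
    exact (by fun_prop : Continuous fun u : ℝ =>
      b n * (((u - lam n) ^ m * (x - u) ^ q : ℝ) : ℂ)).integrableOn_Ioc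

theorem norm_sum_below_rpow_le (lam : Frequency) (b : ℕ → ℂ) {m q C : ℝ} (hm : 0 ≤ m)
    (hq : 0 ≤ q) (hC : ∀ u, 0 < u →
      ‖∑ n ∈ lam.below u, b n * (((u - lam n) ^ m : ℝ) : ℂ)‖ ≤ C * (1 + u) ^ m) :
    ∃ C' : ℝ, 0 ≤ C' ∧ ∀ x, 0 ≤ x →
      ‖∑ n ∈ lam.below x, b n * (((x - lam n) ^ (m + q + 1) : ℝ) : ℂ)‖ ≤
        C' * (1 + x) ^ (m + q + 1) := by
  have hB := integral_rpow_mul_rpow_pos hm hq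
  have hC0 : 0 ≤ C := by
    have h1 := (norm_nonneg _).trans (hC 1 one_pos)
    by_contra! hneg
    have : (0 : ℝ) < (1 + 1) ^ m := by positivity
    nlinarith
  set B := ∫ v in (0 : ℝ)..1, v ^ m * (1 - v) ^ q
  refine ⟨C / B, by positivity, fun x hx => ?_⟩
  have h1 := integral_sum_below_mul_rpow lam b (x := x) hm hq
  have h2 : ‖∫ u in Ioc 0 x, (∑ n ∈ lam.below u, b n * (((u - lam n) ^ m : ℝ) : ℂ)) *
      (((x - u) ^ q : ℝ) : ℂ)‖ ≤ C * (1 + x) ^ m * (1 + x) ^ q * volume.real (Ioc 0 x) := by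
    refine norm_setIntegral_le_of_norm_le_const (by simp) fun u hu => ?_
    rw [norm_mul, Complex.norm_real,
      Real.norm_of_nonneg (Real.rpow_nonneg (sub_nonneg.2 hu.2) _)]
    have := sub_nonneg.2 hu.2
    have := hu.1
    refine mul_le_mul ((hC u hu.1).trans ?_) ?_ (by positivity) (by positivity)
    · gcongr
      exact hu.2
    · gcongr
      linarith
  rw [h1, norm_mul, Complex.norm_real, Real.norm_of_nonneg hB.le] at h2
  rw [div_mul_eq_mul_div, le_div_iff₀ hB, mul_comm]
  refine h2.trans ?_
  rw [Real.volume_real_Ioc_of_le hx, sub_zero, Real.rpow_add (by positivity),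
    Real.rpow_add (by positivity), Real.rpow_one]
  have : 0 ≤ C * (1 + x) ^ m * (1 + x) ^ q := by positivity
  nlinarith

/-- Convergence controls large u; for the rest, D bounds a fixed finite sum. -/
theorem RieszSummableTo.exists_bound {lam : Frequency} {k : ℝ≥0} {a : ℕ → ℂ} {s z : ℂ}
    (h : RieszSummableTo lam k a s z) :
    ∃ C : ℝ, ∀ u, 0 < u → ‖∑ n ∈ lam.below u, a n * Complex.exp (-(lam n : ℂ) * s) *
      (((u - lam n) ^ (k : ℝ) : ℝ) : ℂ)‖ ≤ C * (1 + u) ^ (k : ℝ) := by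
  have hk : (0 : ℝ) ≤ k := k.2
  obtain ⟨X, hX⟩ := eventually_atTop.1 (h.norm.eventually_le_const (lt_add_one ‖z‖))
  set Y := max X 0 with hY
  set D := ∑ n ∈ lam.below Y, ‖a n * Complex.exp (-(lam n : ℂ) * s)‖ * Y ^ (k : ℝ) with hD
  have hD0 : 0 ≤ D := Finset.sum_nonneg fun n _ =>
    mul_nonneg (norm_nonneg _) (Real.rpow_nonneg (le_max_right _ _) _)
  refine ⟨‖z‖ + 1 + D, fun u hu => ?_⟩
  rcases le_or_gt Y u with hle | hlt
  · have h1 := hX u ((le_max_left _ _).trans hle)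
    have h2 : ∑ n ∈ lam.below u, a n * Complex.exp (-(lam n : ℂ) * s) *
        (((u - lam n) ^ (k : ℝ) : ℝ) : ℂ) = ((u ^ (k : ℝ) : ℝ) : ℂ) * rieszMean lam k a u s := by
      rw [rieszMean, Finset.mul_sum]
      refine Finset.sum_congr rfl fun n hn => ?_
      have hn' := Frequency.mem_below.1 hn
      rw [one_sub_div hu.ne', Real.div_rpow (by linarith) hu.le, mul_left_comm,
        ← Complex.ofReal_mul, mul_div_cancel₀]
      exact (Real.rpow_pos_of_pos hu _).ne'
    rw [h2, norm_mul, Complex.norm_real, Real.norm_of_nonneg (by positivity), mul_comm]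
    gcongr
    · linarith
    · linarith
  · have h1 : ‖∑ n ∈ lam.below u, a n * Complex.exp (-(lam n : ℂ) * s) *
        (((u - lam n) ^ (k : ℝ) : ℝ) : ℂ)‖ ≤ D := by
      refine (norm_sum_le _ _).trans ((Finset.sum_le_sum fun n hn => ?_).trans
        (Finset.sum_le_sum_of_subset_of_nonneg (fun n hn => Frequency.mem_below.2
          ((Frequency.mem_below.1 hn).trans hlt)) fun n _ _ =>
          mul_nonneg (norm_nonneg _) (Real.rpow_nonneg (le_max_right _ _) _)))
      have hn' := Frequency.mem_below.1 hn
      rw [norm_mul, Complex.norm_real, Real.norm_of_nonneg (Real.rpow_nonneg (by linarith) _)]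
      gcongr
      linarith [lam.nonneg n]
    have h2 : 1 ≤ (1 + u) ^ (k : ℝ) := Real.one_le_rpow (by linarith) hk
    nlinarith [norm_nonneg z]

/-- The p-th difference with step t of the p-th power is constant. -/
theorem sum_alternating_choose_mul_pow (p : ℕ) (y : ℝ) {t : ℝ} (ht : t ≠ 0) :
    ∑ k ∈ Finset.range (p + 1), (((-1 : ℤ) ^ (p - k) * p.choose k : ℤ) : ℝ) * (y + k * t) ^ p =
      t ^ p * p.factorial := by
  have h1 := congrFun (fwdDiff_iter_eq_factorial (R := ℝ) (n := p)) (y / t)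
  rw [fwdDiff_iter_eq_sum_shift] at h1
  have h2 : ((p.factorial : ℝ → ℝ) (y / t)) = (p.factorial : ℝ) := by simp
  rw [h2] at h1
  rw [← h1, Finset.mul_sum]
  refine Finset.sum_congr rfl fun k _ => ?_
  rw [zsmul_eq_mul, nsmul_eq_mul, mul_one, mul_left_comm, ← mul_pow]
  congr 2
  field_simp

/-- On [λ_N, λ_{N+1}] the Riesz sum of integer order p is a polynomial in x of degree at most p
whose x^p coefficient is the partial sum up to N. A p-th difference with p t at most the gap
recovers p! t^p times that partial sum. -/
theorem norm_partialSum_le {lam : Frequency} {b : ℕ → ℂ} {p : ℕ} (hp : p ≠ 0) {C : ℝ}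
    (hC : ∀ x, 0 ≤ x → ‖∑ n ∈ lam.below x, b n * (((x - lam n) ^ p : ℝ) : ℂ)‖ ≤ C * (1 + x) ^ p)
    (N : ℕ) {t : ℝ} (ht : 0 < t) (ht1 : p * t ≤ 1) (htN : p * t ≤ lam (N + 1) - lam N) :
    ‖∑ n ∈ Finset.range (N + 1), b n‖ ≤ 2 ^ p * C * (2 + lam N) ^ p * (t⁻¹) ^ p := by
  have hlam := lam.nonneg N
  have hC0 : 0 ≤ C := by simpa using (norm_nonneg _).trans (hC 0 le_rfl)
  have h1 : ∀ k ∈ Finset.range (p + 1),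
      ∑ n ∈ lam.below (lam N + k * t), b n * (((lam N + k * t - lam n) ^ p : ℝ) : ℂ) =
      ∑ n ∈ Finset.range (N + 1), b n * (((lam N + k * t - lam n) ^ p : ℝ) : ℂ) := by
    intro k hk
    have hkp : (k : ℝ) ≤ p := by exact_mod_cast Finset.mem_range_succ_iff.1 hk
    have hkt : (k : ℝ) * t ≤ p * t := by gcongr
    have hk0 : 0 ≤ (k : ℝ) * t := by positivity
    -- Endpoints: at node λ_N the index N is missing from `below`, but its term is 0^p with p ≠ 0; a
    -- node at λ_{N+1} still excludes N+1, as `below` is strict.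
    refine Finset.sum_subset (fun n hn => ?_) fun n hn hn' => ?_
    · have := Frequency.mem_below.1 hn
      exact Finset.mem_range.2 (lam.strictMono.lt_iff_lt.1 (by linarith))
    · rw [Frequency.mem_below, not_lt] at hn'
      have := lam.strictMono.monotone (Finset.mem_range_succ_iff.1 hn)
      rw [show lam N + k * t - lam n = 0 by linarith, zero_pow hp]
      simp
  have h2 : ((t ^ p * p.factorial : ℝ) : ℂ) * ∑ n ∈ Finset.range (N + 1), b n =
      ∑ k ∈ Finset.range (p + 1), ((((-1 : ℤ) ^ (p - k) * p.choose k : ℤ) : ℝ) : ℂ) *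
        ∑ n ∈ lam.below (lam N + k * t), b n * (((lam N + k * t - lam n) ^ p : ℝ) : ℂ) := by
    refine Eq.trans ?_ (Finset.sum_congr rfl fun k hk => by rw [h1 k hk]).symm
    simp_rw [Finset.mul_sum]
    rw [Finset.sum_comm]
    refine Finset.sum_congr rfl fun n _ => ?_
    rw [← sum_alternating_choose_mul_pow p (lam N - lam n) ht.ne', Complex.ofReal_sum,
      Finset.sum_mul]
    refine Finset.sum_congr rfl fun k _ => ?_
    rw [show lam N - lam n + k * t = lam N + k * t - lam n by ring]
    push_cast
    ring
  have h3 : ‖((t ^ p * p.factorial : ℝ) : ℂ) * ∑ n ∈ Finset.range (N + 1), b n‖ ≤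
      2 ^ p * (C * (2 + lam N) ^ p) := by
    rw [h2]
    have hchoose : ∑ k ∈ Finset.range (p + 1), (p.choose k : ℝ) = 2 ^ p := by
      exact_mod_cast Nat.sum_range_choose p
    rw [← hchoose, Finset.sum_mul]
    refine norm_sum_le_of_le _ fun k hk => ?_
    have hkp : (k : ℝ) ≤ p := by exact_mod_cast Finset.mem_range_succ_iff.1 hk
    have hkt : (k : ℝ) * t ≤ p * t := by gcongr
    rw [norm_mul, Complex.norm_real]
    refine mul_le_mul (le_of_eq ?_) ((hC _ (by positivity)).trans ?_) (norm_nonneg _)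
      (by positivity)
    · push_cast
      simp
    · gcongr ?_ * ?_ ^ p
      linarith
  have h4 : 0 < t ^ p := by positivity
  have h5 : (1 : ℝ) ≤ p.factorial := by exact_mod_cast p.factorial_pos
  rw [norm_mul, Complex.norm_real, Real.norm_of_nonneg (by positivity)] at h3
  rw [inv_pow, ← div_eq_mul_inv, le_div_iff₀ h4]
  calc ‖∑ n ∈ Finset.range (N + 1), b n‖ * t ^ p
      ≤ ‖∑ n ∈ Finset.range (N + 1), b n‖ * (t ^ p * p.factorial) := by
        gcongr
        exact le_mul_of_one_le_right h4.le h5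
    _ ≤ 2 ^ p * (C * (2 + lam N) ^ p) := by rw [mul_comm]; exact h3
    _ = _ := by ring

/-- The terms of a Riesz summable Dirichlet series grow at most exponentially. -/
theorem RieszSummableTo.exists_norm_term_le {lam : Frequency} {β : ℝ} (hβ : 0 ≤ β)
    (hBC : BohrCondition lam β) {k : ℝ≥0} {a : ℕ → ℂ} {s z : ℂ}
    (h : RieszSummableTo lam k a s z) :
    ∃ C d : ℝ, 0 ≤ C ∧ 0 ≤ d ∧
      ∀ n, ‖a n * Complex.exp (-(lam n : ℂ) * s)‖ ≤ C * Real.exp (d * lam n) := by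
  obtain ⟨c, hc, hc1, hgap⟩ := hBC.exists_gap
  obtain ⟨C₀, hC₀⟩ := h.exists_bound
  set b : ℕ → ℂ := fun n => a n * Complex.exp (-(lam n : ℂ) * s) with hb
  -- The order k is raised by ⌈k⌉ - k + 1 to this integer.
  set p : ℕ := ⌈(k : ℝ)⌉₊ + 1 with hp
  obtain ⟨C₁, hC₁, h₁⟩ := norm_sum_below_rpow_le lam b (q := ⌈(k : ℝ)⌉₊ - k) k.coe_nonneg
    (sub_nonneg.2 (Nat.le_ceil _)) hC₀
  have hkp : (k : ℝ) + (⌈(k : ℝ)⌉₊ - k) + 1 = (p : ℕ) := by push_cast [hp]; ring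
  simp_rw [hkp, Real.rpow_natCast] at h₁
  have hp1 : (1 : ℝ) ≤ p := by push_cast [hp]; linarith [(Nat.cast_nonneg ⌈(k : ℝ)⌉₊ : (0 : ℝ) ≤ _)]
  set C₂ : ℝ := 2 ^ p * C₁ * 2 ^ p * (p * c⁻¹) ^ p with hC₂
  have hC₂0 : 0 ≤ C₂ := by positivity
  set d : ℝ := p * (1 + β) with hd
  have hd0 : 0 ≤ d := by positivity
  have hS : ∀ N, ‖∑ n ∈ Finset.range (N + 1), b n‖ ≤ C₂ * Real.exp (d * lam N) := by
    intro N
    have hlam := lam.nonneg N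
    -- The step c e^{-βλ_N}/p makes the p steps fit exactly into the guaranteed gap.
    have ht : 0 < c * Real.exp (-(β * lam N)) / p := by positivity
    have hpt : p * (c * Real.exp (-(β * lam N)) / p) = c * Real.exp (-(β * lam N)) := by
      field_simp
    have h2 := norm_partialSum_le (by simp [hp]) h₁ N ht (by
      rw [hpt]
      exact mul_le_one₀ hc1 (Real.exp_pos _).le
        (Real.exp_le_one_iff.2 (neg_nonpos.2 (mul_nonneg hβ hlam)))) (by rw [hpt]; exact hgap N)
    refine h2.trans ?_
    have h3 : 2 + lam N ≤ 2 * Real.exp (lam N) := by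
      linarith [Real.add_one_le_exp (lam N)]
    calc 2 ^ p * C₁ * (2 + lam N) ^ p * ((c * Real.exp (-(β * lam N)) / p)⁻¹) ^ p
        ≤ 2 ^ p * C₁ * (2 * Real.exp (lam N)) ^ p *
          ((c * Real.exp (-(β * lam N)) / p)⁻¹) ^ p := by gcongr
      _ = C₂ * (Real.exp (lam N) * Real.exp (β * lam N)) ^ p := by
          rw [hC₂, Real.exp_neg, inv_div, div_eq_mul_inv, mul_inv, inv_inv]
          ring
      _ = _ := by
          rw [← Real.exp_add, ← Real.exp_nat_mul, hd]
          ring_nf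
  refine ⟨2 * C₂, d, by positivity, hd0, fun n => ?_⟩
  change ‖b n‖ ≤ _
  have hn := hS n
  rcases n with _ | n
  · have h4 : 0 ≤ C₂ * Real.exp (d * lam 0) := by positivity
    rw [Finset.sum_range_one] at hn
    linarith
  · rw [show b (n + 1) = ∑ i ∈ Finset.range (n + 1 + 1), b i - ∑ i ∈ Finset.range (n + 1), b i by
      rw [Finset.sum_range_succ _ (n + 1)]; ring]
    have h4 : C₂ * Real.exp (d * lam n) ≤ C₂ * Real.exp (d * lam (n + 1)) := by
      gcongr
      exact lam.strictMono.monotone n.le_succ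
    have := norm_sub_le (∑ i ∈ Finset.range (n + 1 + 1), b i) (∑ i ∈ Finset.range (n + 1), b i)
    linarith [hS n]

theorem rieszSummableTo_tsum {lam : Frequency} (k : ℝ≥0) {a : ℕ → ℂ} {s : ℂ}
    (h : Summable fun n => ‖a n * Complex.exp (-(lam n : ℂ) * s)‖) :
    RieszSummableTo lam k a s (∑' n, a n * Complex.exp (-(lam n : ℂ) * s)) := by
  have h1 : ∀ x, rieszMean lam k a x s = ∑' n, if n ∈ lam.below x then
      a n * Complex.exp (-(lam n : ℂ) * s) * (((1 - lam n / x) ^ (k : ℝ) : ℝ) : ℂ) else 0 := by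
    intro x
    rw [rieszMean, tsum_eq_sum (s := lam.below x) fun n hn => if_neg hn]
    exact Finset.sum_congr rfl fun n hn => (if_pos hn).symm
  unfold RieszSummableTo
  simp_rw [h1]
  refine tendsto_tsum_of_dominated_convergence h (fun n => ?_) ?_
  · have h2 := ((Complex.continuous_ofReal.tendsto _).comp
      (tendsto_sub_div_rpow (lam n) k)).const_mul (a n * Complex.exp (-(lam n : ℂ) * s))
    rw [Complex.ofReal_one, mul_one] at h2
    refine h2.congr' ?_
    filter_upwards [eventually_gt_atTop (lam n)] with x hx
    rw [if_pos (Frequency.mem_below.2 hx)]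
    rfl
  · filter_upwards [eventually_gt_atTop 0] with x hx n
    split_ifs with hn
    · have hn' := Frequency.mem_below.1 hn
      have h3 : 0 ≤ 1 - lam n / x := sub_nonneg.2 ((div_le_one hx).2 hn'.le)
      rw [norm_mul, Complex.norm_real, Real.norm_of_nonneg (Real.rpow_nonneg h3 _)]
      refine mul_le_of_le_one_right (norm_nonneg _) (Real.rpow_le_one h3 ?_ k.2)
      linarith [div_nonneg (lam.nonneg n) hx.le]
    · simp

/-- At σ₀ the terms are O(e^{dλ_n}), so moving right by d + 2β gives absolute convergence. There
Riesz limits of every order equal the ordinary sum, which identifies it with f. -/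
theorem IsRieszGerm.exists_expansion {lam : Frequency} {β : ℝ} (hβ : 0 < β)
    (hBC : BohrCondition lam β) {ℓ : ℝ≥0} {a : ℕ → ℂ} {f : RightHalfPlane → ℂ} {A : ℝ}
    (hf : IsHolomorphic f) (ha : IsRieszGerm lam a f) (hA : ∀ s, growthQuotient ℓ f s ≤ A) :
    ∃ F : ℂ → ℂ, (∀ s : RightHalfPlane, F s = f s) ∧ HasDirichletExpansion lam ℓ a F A := by
  obtain ⟨F, hFd, hF⟩ := hf
  obtain ⟨m, σ, hm⟩ := ha
  set σ₀ : ℝ := max σ 0 + 1 with hσ₀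
  have h0 : 0 < σ₀ := by have := le_max_right σ 0; linarith
  have hσ : σ < σ₀ := by have := le_max_left σ 0; linarith
  obtain ⟨C, d, hC, hd, hterm⟩ := (hm ⟨σ₀, by simpa using h0⟩ (by simpa using hσ)).exists_norm_term_le
    hβ.le hBC
  have hsum : Summable fun n => ‖a n‖ * Real.exp (-(lam n * (σ₀ + d + 2 * β))) := by
    refine Summable.of_nonneg_of_le (fun n => by positivity) (fun n => ?_)
      ((summable_exp_neg_two_mul hβ hBC).mul_left C)
    have h1 := hterm n
    rw [norm_mul, Complex.norm_exp] at h1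
    simp only [neg_mul, Complex.neg_re, Complex.re_ofReal_mul, Complex.ofReal_re] at h1
    calc ‖a n‖ * Real.exp (-(lam n * (σ₀ + d + 2 * β)))
        = ‖a n‖ * Real.exp (-(lam n * σ₀)) * Real.exp (-(d * lam n) + -(2 * β * lam n)) := by
          rw [mul_assoc, ← Real.exp_add]; ring_nf
      _ ≤ C * Real.exp (d * lam n) * Real.exp (-(d * lam n) + -(2 * β * lam n)) := by gcongr
      _ = C * Real.exp (-(2 * β * lam n)) := by
          rw [mul_assoc, ← Real.exp_add]; ring_nf
  refine ⟨F, hF, hFd, fun s hs => ?_, σ₀ + d + 2 * β, by positivity, hsum, fun s hs => ?_⟩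
  · have h1 := hA ⟨s, hs⟩
    rw [growthQuotient, div_le_iff₀ (by positivity), ← hF] at h1
    exact h1
  · have hs0 : 0 < s.re := by linarith
    have hs' := HasDirichletExpansion.summable_norm_of_le hsum hs
    have h1 := hm ⟨s, hs0⟩ (by simp only; linarith)
    rw [← hF] at h1
    rw [tendsto_nhds_unique h1 (rieszSummableTo_tsum m hs')]
    exact hs'.of_norm.hasSum

/-! ### The space `D_{∞,ℓ}(lam)` -/

namespace DSpace

variable {lam : Frequency} {ℓ : ℝ≥0}

theorem norm_limitFun_le (D : DSpace lam ℓ) (s : RightHalfPlane) :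
    ‖D.limitFun s‖ ≤ ‖D‖ * (1 + ‖(s : ℂ)‖) ^ (ℓ : ℝ) := by
  have h : growthQuotient ℓ D.limitFun s ≤ ‖D‖ := le_ciSup D.limitMap_bdd s
  rwa [growthQuotient, div_le_iff₀ (by positivity)] at h

theorem norm_le_of_forall {D : DSpace lam ℓ} {η : ℝ}
    (h : ∀ s : RightHalfPlane, ‖D.limitFun s‖ ≤ η * (1 + ‖(s : ℂ)‖) ^ (ℓ : ℝ)) : ‖D‖ ≤ η := by
  have : Nonempty RightHalfPlane := ⟨⟨1, by simp⟩⟩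
  refine ciSup_le fun s => ?_
  change growthQuotient ℓ D.limitFun s ≤ η
  rw [growthQuotient, div_le_iff₀ (by positivity)]
  exact h s

theorem limitFun_sub (D E : DSpace lam ℓ) (s : RightHalfPlane) :
    (D - E).limitFun s = D.limitFun s - E.limitFun s :=
  congrFun (map_sub limitMap D E) s

theorem limitFun_translate {u : ℝ} (hu : 0 < u) (D : DSpace lam ℓ) (s : RightHalfPlane) :
    (translate u hu D).limitFun s = D.limitFun (shift u hu s) := by
  refine congrFun (limitFun_eq (f := fun s => D.limitFun (shift u hu s)) fun s => ?_) s
  refine (D.summable_limitFun (shift u hu s)).congr fun x => ?_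
  refine Finset.sum_congr rfl fun n _ => ?_
  change _ = D.coeff n * Complex.exp (-(lam n : ℂ) * u) * _ * _
  simp only [shift, mul_add, Complex.exp_add, mul_assoc]

theorem isRieszGerm (D : DSpace lam ℓ) : IsRieszGerm lam D.coeff D.limitFun :=
  ⟨ℓ, 0, fun s _ => D.summable_limitFun s⟩

theorem exists_expansion {β : ℝ} (hβ : 0 < β) (hBC : BohrCondition lam β) (D : DSpace lam ℓ) :
    ∃ F : ℂ → ℂ, (∀ s : RightHalfPlane, F s = D.limitFun s) ∧
      HasDirichletExpansion lam ℓ D.coeff F ‖D‖ :=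
  D.isRieszGerm.exists_expansion hβ hBC D.limitFun_mem.1 fun s => le_ciSup D.limitMap_bdd s

end DSpace

theorem HasDirichletExpansion.exists_dSpace {lam : Frequency} {ℓ : ℝ≥0} {β : ℝ} (hβ : 0 ≤ β)
    (hBC : BohrCondition lam β) {a : ℕ → ℂ} {F : ℂ → ℂ} {A : ℝ}
    (h : HasDirichletExpansion lam ℓ a F A) :
    ∃ E : DSpace lam ℓ, E.coeff = a ∧ ∀ s : RightHalfPlane, E.limitFun s = F s := by
  have hs : ∀ s : RightHalfPlane, RieszSummableTo lam ℓ a s (F s) := fun s =>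
    h.rieszSummableTo hβ hBC s.2
  have hmem : a ∈ dirichletSubmodule lam ℓ := by
    refine ⟨fun s => F s, ⟨⟨F, h.differentiableOn, fun _ => rfl⟩, ⟨a, ℓ, 0, fun s _ => hs s⟩, A, ?_⟩,
      hs⟩
    rintro _ ⟨s, rfl⟩
    rw [growthQuotient, div_le_iff₀ (by positivity)]
    exact h.bound s s.2
  let E : DSpace lam ℓ := ⟨a, hmem⟩
  exact ⟨E, rfl, fun s => congrFun (DSpace.limitFun_eq (D := E) hs) s⟩

theorem IsRieszGerm.unique {lam : Frequency} {ℓ : ℝ≥0} {β : ℝ} (hβ : 0 < β)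
    (hBC : BohrCondition lam β) {f : RightHalfPlane → ℂ} (hf : f ∈ HSpace lam ℓ) {a b : ℕ → ℂ}
    (ha : IsRieszGerm lam a f) (hb : IsRieszGerm lam b f) : a = b := by
  obtain ⟨hhol, -, A, hA⟩ := hf
  obtain ⟨F, hF, hFa⟩ := ha.exists_expansion hβ hBC hhol fun s => hA ⟨s, rfl⟩
  obtain ⟨G, hG, hGb⟩ := hb.exists_expansion hβ hBC hhol fun s => hA ⟨s, rfl⟩
  exact hFa.coeff_unique hβ.le hBC ℓ.2 hGb fun s hs => (hF ⟨s, hs⟩).trans (hG ⟨s, hs⟩).symm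

theorem germsSummable {lam : Frequency} {β : ℝ} (hβ : 0 < β) (hBC : BohrCondition lam β)
    (ℓ : ℝ≥0) : GermsSummable lam ℓ := by
  rintro f ⟨hhol, -, A, hA⟩ a ha s
  obtain ⟨F, hF, h⟩ := ha.exists_expansion hβ hBC hhol fun s => hA ⟨s, rfl⟩
  rw [← hF s]
  exact h.rieszSummableTo hβ.le hBC s.2

theorem limitMap_injective {lam : Frequency} {β : ℝ} (hβ : 0 < β) (hBC : BohrCondition lam β)
    (ℓ : ℝ≥0) : Function.Injective
      (DSpace.limitMap : DSpace lam ℓ →ₗ[ℂ] (RightHalfPlane → ℂ)) := by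
  intro D E h
  have hE : IsRieszGerm lam E.coeff D.limitFun := by
    rw [show D.limitFun = E.limitFun from h]
    exact E.isRieszGerm
  exact Subtype.ext (D.isRieszGerm.unique hβ hBC D.limitFun_mem hE)

theorem spacesCoincide {lam : Frequency} {β : ℝ} (hβ : 0 < β) (hBC : BohrCondition lam β)
    (ℓ : ℝ≥0) : SpacesCoincide lam ℓ := by
  refine ⟨⟨fun D _ => D.limitFun_mem, (limitMap_injective hβ hBC ℓ).injOn, fun f hf => ?_⟩,
    fun D => ⟨rfl, ?_⟩⟩
  · obtain ⟨a, ha⟩ := hf.2.1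
    have hs := germsSummable hβ hBC ℓ f hf a ha
    exact ⟨(⟨a, f, hf, hs⟩ : dirichletSubmodule lam ℓ), mem_univ _, DSpace.limitFun_eq hs⟩
  · have hex : ∃ a, IsRieszGerm lam a (DSpace.limitMap D) := ⟨_, D.isRieszGerm⟩
    rw [bohrCoeff, dif_pos hex]
    exact IsRieszGerm.unique hβ hBC D.limitFun_mem hex.choose_spec D.isRieszGerm

/-! ### Montel's theorem and completeness -/

/-- Tail blocks are small uniformly over the class with constant B, since they decay like e^{-um};
the head involves only finitely many coefficients. Thus on bounded sets coefficientwise convergence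
controls translated norms. -/
theorem exists_small_of_coeff_small (lam : Frequency) {ℓ : ℝ} (hℓ : 0 ≤ ℓ) {u η : ℝ} (hu : 0 < u)
    (hη : 0 < η) (B : ℝ) : ∃ (S : Finset ℕ) (δ : ℝ), 0 < δ ∧
      ∀ (a : ℕ → ℂ) (F : ℂ → ℂ), HasDirichletExpansion lam ℓ a F B → (∀ n ∈ S, ‖a n‖ ≤ δ) →
        ∀ s : ℂ, 0 < s.re → ‖F (s + u)‖ ≤ η * (1 + ‖s‖) ^ ℓ := by
  obtain ⟨C, hC, hblock⟩ := exists_norm_smoothBlock_le lam hℓ u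
  have hexp := summable_exp_neg_mul_nat hu
  have htail := (tendsto_sum_nat_add fun m : ℕ => Real.exp (-(u * m))).const_mul (C * B)
  rw [mul_zero] at htail
  obtain ⟨M, hM⟩ := (htail.eventually_le_const (half_pos hη)).exists
  set S := lam.below (M + 1) with hS
  -- The head has M blocks of at most |S| terms each, so M|S|δ ≤ η/2; the +1 keeps the denominator
  -- positive.
  refine ⟨S, η / 2 / (M * S.card + 1), by positivity, fun a F h ha s hs => ?_⟩
  have hsu : 0 < (s + u).re := by simpa using add_pos hs hu
  have hsum := h.hasSum_smoothBlock hℓ hsu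
  have h1 : 1 ≤ (1 + ‖s‖) ^ ℓ := Real.one_le_rpow (by linarith [norm_nonneg s]) hℓ
  rw [← hsum.tsum_eq, ← hsum.summable.sum_add_tsum_nat_add M, ← add_halves η, add_mul]
  refine (norm_add_le _ _).trans (add_le_add ?_ ?_)
  · have hhead : ∀ m ∈ Finset.range M, ‖smoothBlock lam a m (s + u)‖ ≤
        S.card * (η / 2 / (M * S.card + 1)) := by
      intro m hm
      have hmM : (m : ℝ) ≤ M := by exact_mod_cast (Finset.mem_range.1 hm).le
      have hsub : lam.below (m + 1) ⊆ S := fun n hn => by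
        rw [hS, Frequency.mem_below]
        rw [Frequency.mem_below] at hn
        linarith
      calc ‖smoothBlock lam a m (s + u)‖
          ≤ ∑ n ∈ lam.below (m + 1), η / 2 / (M * S.card + 1) := by
            refine norm_sum_le_of_le _ fun n hn => ?_
            rw [norm_mul, norm_mul, Complex.norm_real, Real.norm_of_nonneg (hat_nonneg _),
              Complex.norm_exp, mul_assoc]
            refine (mul_le_of_le_one_right (norm_nonneg _) (mul_le_one₀ ?_ (hat_nonneg _)
              (hat_le_one _))).trans (ha n (hsub hn))
            rw [Real.exp_le_one_iff, neg_mul, Complex.neg_re, Complex.re_ofReal_mul]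
            exact neg_nonpos.2 (mul_nonneg (lam.nonneg n) hsu.le)
        _ ≤ ∑ n ∈ S, η / 2 / (M * S.card + 1) :=
            Finset.sum_le_sum_of_subset_of_nonneg hsub fun _ _ _ => by positivity
        _ = _ := by rw [Finset.sum_const, nsmul_eq_mul]
    refine (norm_sum_le_of_le _ hhead).trans ?_
    rw [Finset.sum_const, Finset.card_range, nsmul_eq_mul]
    calc (M : ℝ) * (S.card * (η / 2 / (M * S.card + 1)))
        = η / 2 * (M * S.card / (M * S.card + 1)) := by ring
      _ ≤ η / 2 * 1 := by
          gcongr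
          exact (div_le_one (by positivity)).2 (by linarith)
      _ ≤ η / 2 * (1 + ‖s‖) ^ ℓ := by gcongr
  · have hb : ∀ m : ℕ, ‖smoothBlock lam a (m + M) (s + u)‖ ≤
        C * (B * (1 + ‖s‖) ^ ℓ) * Real.exp (-(u * (m + M : ℕ))) :=
      fun m => hblock a F B h s hs (m + M)
    refine (tsum_of_norm_bounded ((((summable_nat_add_iff M).2 hexp).hasSum).mul_left
      (C * (B * (1 + ‖s‖) ^ ℓ))) hb).trans ?_
    calc C * (B * (1 + ‖s‖) ^ ℓ) * ∑' m : ℕ, Real.exp (-(u * (m + M : ℕ)))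
        = C * B * (∑' m : ℕ, Real.exp (-(u * (m + M : ℕ)))) * (1 + ‖s‖) ^ ℓ := by ring
      _ ≤ _ := by gcongr

theorem HasDirichletExpansion.mono {lam : Frequency} {ℓ : ℝ} {a : ℕ → ℂ} {F : ℂ → ℂ} {A B : ℝ}
    (h : HasDirichletExpansion lam ℓ a F A) (hAB : A ≤ B) : HasDirichletExpansion lam ℓ a F B :=
  ⟨h.differentiableOn, fun s hs => (h.bound s hs).trans (by gcongr), h.series⟩

/-- The half-plane in an expansion may depend on the function. Riesz summability identifies F with
its series wherever that converges absolutely, so a whole sequence can use one common half-plane. -/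
theorem HasDirichletExpansion.eq_tsum {lam : Frequency} {ℓ : ℝ≥0} {β : ℝ} (hβ : 0 ≤ β)
    (hBC : BohrCondition lam β) {a : ℕ → ℂ} {F : ℂ → ℂ} {A : ℝ}
    (h : HasDirichletExpansion lam ℓ a F A) {s : ℂ} (hs : 0 < s.re)
    (hsum : Summable fun n => ‖a n * Complex.exp (-(lam n : ℂ) * s)‖) :
    F s = ∑' n, a n * Complex.exp (-(lam n : ℂ) * s) :=
  tendsto_nhds_unique (h.rieszSummableTo hβ hBC hs) (rieszSummableTo_tsum ℓ hsum)

/-- Bounded sequences of functions with convergent Bohr coefficients converge on every half-plane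
`[Re > u]`, `u > 0`, uniformly up to the weight. -/
theorem exists_limit_expansion {lam : Frequency} {ℓ : ℝ≥0} {β : ℝ} (hβ : 0 < β)
    (hBC : BohrCondition lam β) {B : ℝ} {b : ℕ → ℕ → ℂ} {G : ℕ → ℂ → ℂ} {a : ℕ → ℂ}
    (hG : ∀ j, HasDirichletExpansion lam ℓ (b j) (G j) B) (hb : Tendsto b atTop (𝓝 a)) :
    ∃ F : ℂ → ℂ, HasDirichletExpansion lam ℓ a F B ∧ ∀ u : ℝ, 0 < u → ∀ η : ℝ, 0 < η →
      ∀ᶠ j in atTop, ∀ s : ℂ, 0 < s.re → ‖G j (s + u) - F (s + u)‖ ≤ η * (1 + ‖s‖) ^ (ℓ : ℝ) := by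
  have hℓ : (0 : ℝ) ≤ ℓ := ℓ.2
  have hB := (hG 0).nonneg
  rw [tendsto_pi_nhds] at hb
  -- Differences of two members have constant 2B and coefficients that become small on any finite
  -- set.
  have hcauchy : ∀ u : ℝ, 0 < u → ∀ η : ℝ, 0 < η → ∃ J, ∀ i ≥ J, ∀ j ≥ J, ∀ s : ℂ, 0 < s.re →
      ‖G i (s + u) - G j (s + u)‖ ≤ η * (1 + ‖s‖) ^ (ℓ : ℝ) := by
    intro u hu η hη
    obtain ⟨S, δ, hδ, hsmall⟩ := exists_small_of_coeff_small lam hℓ hu hη (B + B)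
    have hev : ∀ᶠ j in atTop, ∀ n ∈ S, dist (b j n) (a n) < δ / 2 :=
      (Finset.eventually_all S).2 fun n _ => Metric.tendsto_nhds.1 (hb n) _ (half_pos hδ)
    obtain ⟨J, hJ⟩ := eventually_atTop.1 hev
    refine ⟨J, fun i hi j hj s hs => hsmall _ _ ((hG i).sub (hG j)) (fun n hn => ?_) s hs⟩
    rw [Pi.sub_apply, ← dist_eq_norm]
    have := dist_triangle_right (b i n) (b j n) (a n)
    linarith [hJ i hi n hn, hJ j hj n hn]
  have hlim : ∀ s : ℂ, ∃ z, 0 < s.re → Tendsto (fun j => G j s) atTop (𝓝 z) := by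
    intro s
    by_cases hs : 0 < s.re
    · have hs2 : 0 < (s - (s.re / 2 : ℝ)).re := by simp; linarith
      have hc : CauchySeq fun j => G j s := by
        refine Metric.cauchySeq_iff.2 fun ε hε => ?_
        have hw : 0 < (1 + ‖s - (s.re / 2 : ℝ)‖) ^ (ℓ : ℝ) := by positivity
        obtain ⟨J, hJ⟩ := hcauchy _ (half_pos hs) (ε / 2 / (1 + ‖s - (s.re / 2 : ℝ)‖) ^ (ℓ : ℝ))
          (by positivity)
        refine ⟨J, fun i hi j hj => ?_⟩
        have h1 := hJ i hi j hj _ hs2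
        rw [div_mul_cancel₀ _ hw.ne', sub_add_cancel] at h1
        rw [dist_eq_norm]
        linarith
      obtain ⟨z, hz⟩ := cauchySeq_tendsto_of_complete hc
      exact ⟨z, fun _ => hz⟩
    · exact ⟨0, fun h => absurd h hs⟩
  choose F hF using hlim
  have hunif : ∀ u : ℝ, 0 < u → ∀ η : ℝ, 0 < η →
      ∀ᶠ j in atTop, ∀ s : ℂ, 0 < s.re →
        ‖G j (s + u) - F (s + u)‖ ≤ η * (1 + ‖s‖) ^ (ℓ : ℝ) := by
    intro u hu η hη
    obtain ⟨J, hJ⟩ := hcauchy u hu η hη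
    filter_upwards [eventually_ge_atTop J] with i hi s hs
    have hlim := ((hF (s + u) (by simpa using add_pos hs hu)).const_sub (G i (s + u))).norm
    refine le_of_tendsto hlim ?_
    filter_upwards [eventually_ge_atTop J] with j hj
    exact hJ i hi j hj s hs
  have hopen : IsOpen {s : ℂ | 0 < s.re} := isOpen_lt continuous_const Complex.continuous_re
  have hloc : TendstoLocallyUniformlyOn G F atTop {s : ℂ | 0 < s.re} := by
    rw [Metric.tendstoLocallyUniformlyOn_iff]
    intro ε hε x hx
    have hx : 0 < x.re := hx
    set R := ‖x‖ + 1 + x.re / 2 with hR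
    have hR0 : 0 ≤ R := by positivity
    have hw : 0 < (1 + R) ^ (ℓ : ℝ) := by positivity
    refine ⟨{y : ℂ | x.re / 2 < y.re} ∩ Metric.ball x 1, mem_nhdsWithin_of_mem_nhds
      (inter_mem ((isOpen_lt continuous_const Complex.continuous_re).mem_nhds (half_lt_self hx))
        (Metric.ball_mem_nhds x one_pos)), ?_⟩
    filter_upwards [hunif _ (half_pos hx) (ε / 2 / (1 + R) ^ (ℓ : ℝ)) (by positivity)]
      with j hj y hy
    have hy1 : x.re / 2 < y.re := hy.1
    have h1 := hj (y - (x.re / 2 : ℝ)) (by simp; linarith)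
    rw [sub_add_cancel] at h1
    rw [dist_comm, dist_eq_norm]
    have hyR : ‖y - (x.re / 2 : ℝ)‖ ≤ R := by
      refine (norm_sub_le _ _).trans ?_
      rw [Complex.norm_real, Real.norm_of_nonneg (half_pos hx).le, hR]
      have h2 := norm_le_norm_add_norm_sub' y x
      have h3 := Metric.mem_ball.1 hy.2
      rw [dist_eq_norm] at h3
      linarith
    refine h1.trans_lt (lt_of_le_of_lt ?_ (half_lt_self hε))
    calc ε / 2 / (1 + R) ^ (ℓ : ℝ) * (1 + ‖y - (x.re / 2 : ℝ)‖) ^ (ℓ : ℝ)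
        ≤ ε / 2 / (1 + R) ^ (ℓ : ℝ) * (1 + R) ^ (ℓ : ℝ) := by gcongr
      _ = ε / 2 := div_mul_cancel₀ _ hw.ne'
  obtain ⟨C, hC, hcoeff⟩ := exists_norm_coeff_le lam hβ.le hBC hℓ
  -- The coefficient bound costs βℓ and summability 2β: from this abscissa on, one majorant serves
  -- all the series and the limit.
  set c : ℝ := β * ℓ + 2 * β with hc
  have hc0 : 0 < c := by positivity
  have hdom : ∀ (d : ℕ → ℂ), (∀ n, ‖d n‖ ≤ C * B * Real.exp (β * ℓ * lam n)) → ∀ s : ℂ, c ≤ s.re →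
      ∀ n, ‖d n * Complex.exp (-(lam n : ℂ) * s)‖ ≤ C * B * Real.exp (-(2 * β * lam n)) := by
    intro d hd s hs n
    have hln := lam.nonneg n
    rw [norm_mul, Complex.norm_exp, neg_mul, Complex.neg_re, Complex.re_ofReal_mul]
    calc ‖d n‖ * Real.exp (-(lam n * s.re))
        ≤ (C * B * Real.exp (β * ℓ * lam n)) * Real.exp (-(lam n * c)) := by
          gcongr
          exact hd n
      _ = _ := by rw [mul_assoc, ← Real.exp_add, hc]; ring_nf
  have hsumexp := (summable_exp_neg_two_mul hβ hBC).mul_left (C * B)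
  have ha : ∀ n, ‖a n‖ ≤ C * B * Real.exp (β * ℓ * lam n) := fun n =>
    le_of_tendsto (hb n).norm (Eventually.of_forall fun j => hcoeff _ _ _ (hG j) n)
  have hnorm : ∀ (d : ℕ → ℂ), (∀ n, ‖d n‖ ≤ C * B * Real.exp (β * ℓ * lam n)) → ∀ s : ℂ,
      c ≤ s.re → Summable fun n => ‖d n * Complex.exp (-(lam n : ℂ) * s)‖ := fun d hd s hs =>
    Summable.of_nonneg_of_le (fun n => norm_nonneg _) (hdom d hd s hs) hsumexp
  refine ⟨F, ⟨hloc.differentiableOn (Eventually.of_forall fun j => (hG j).differentiableOn) hopen,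
    fun s hs => le_of_tendsto (hF s hs).norm (Eventually.of_forall fun j => (hG j).bound s hs),
    c, hc0, ?_, fun s hs => ?_⟩, hunif⟩
  · refine (hnorm a ha c (by simp)).congr fun n => ?_
    rw [norm_mul, Complex.norm_exp, neg_mul, Complex.neg_re, Complex.re_ofReal_mul,
      Complex.ofReal_re]
  · have hs0 : 0 < s.re := hc0.trans_le hs
    have h1 : Tendsto (fun j => ∑' n, b j n * Complex.exp (-(lam n : ℂ) * s)) atTop
        (𝓝 (∑' n, a n * Complex.exp (-(lam n : ℂ) * s))) :=
      tendsto_tsum_of_dominated_convergence hsumexp (fun n => (hb n).mul_const _)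
        (Eventually.of_forall fun j => hdom _ (hcoeff _ _ _ (hG j)) s hs)
    have h2 : F s = ∑' n, a n * Complex.exp (-(lam n : ℂ) * s) := by
      refine tendsto_nhds_unique (hF s hs0) (h1.congr fun j => ?_)
      exact ((hG j).eq_tsum hβ.le hBC hs0 (hnorm _ (hcoeff _ _ _ (hG j)) s hs)).symm
    rw [h2]
    exact (hnorm a ha s hs).of_norm.hasSum

/-- The coefficient estimate confines the coefficient sequences to a product of closed discs, which
is sequentially compact; coefficientwise convergence then gives norm convergence after every
translation. -/
theorem montelHolds {lam : Frequency} {β : ℝ} (hβ : 0 < β) (hBC : BohrCondition lam β)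
    (ℓ : ℝ≥0) : MontelHolds lam ℓ := by
  rintro D ⟨B, hB⟩
  have hB0 : 0 ≤ B := (norm_nonneg _).trans (hB 0)
  choose F hF hexp using fun N => (D N).exists_expansion hβ hBC
  have hexpB := fun N => (hexp N).mono (hB N)
  obtain ⟨C, hC, hcoeff⟩ := exists_norm_coeff_le lam hβ.le hBC ℓ.2
  have hK : IsCompact (Set.pi univ fun n =>
      Metric.closedBall (0 : ℂ) (C * B * Real.exp (β * ℓ * lam n))) :=
    isCompact_univ_pi fun n => isCompact_closedBall _ _
  obtain ⟨a, -, φ, hφ, ha⟩ := hK.tendsto_subseq (x := fun N => (D N).coeff) fun N n _ => by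
    simpa using hcoeff _ _ _ (hexpB N) n
  obtain ⟨G, hG, hunif⟩ := exists_limit_expansion hβ hBC (fun j => hexpB (φ j)) ha
  obtain ⟨E, -, hE⟩ := hG.exists_dSpace hβ.le hBC
  refine ⟨φ, hφ, E, fun u hu => ?_⟩
  rw [tendsto_iff_norm_sub_tendsto_zero, Metric.tendsto_nhds]
  intro ε hε
  filter_upwards [hunif u hu (ε / 2) (half_pos hε)] with j hj
  rw [dist_zero_right, norm_norm]
  refine lt_of_le_of_lt (DSpace.norm_le_of_forall fun s => ?_) (half_lt_self hε)
  rw [DSpace.limitFun_sub, DSpace.limitFun_translate, DSpace.limitFun_translate, hE, ← hF]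
  have := hj s s.2
  rwa [add_comm (s : ℂ) u] at this

/-- Montel's theorem supplies a candidate limit to which a subsequence of a Cauchy sequence
converges pointwise, every s being a translate of a point of the half-plane. Letting that
subsequence run in the Cauchy inequality at each s gives norm convergence. -/
theorem isBanachDSpace {lam : Frequency} {β : ℝ} (hβ : 0 < β) (hBC : BohrCondition lam β)
    (ℓ : ℝ≥0) : IsBanachDSpace lam ℓ := by
  refine ⟨fun D hD => limitMap_injective hβ hBC ℓ ?_, ?_⟩
  · funext s
    have := D.norm_limitFun_le s
    rw [hD, zero_mul, norm_le_zero_iff] at this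
    rw [map_zero]
    exact this
  · refine UniformSpace.complete_of_cauchySeq_tendsto fun D hD => ?_
    obtain ⟨R, hR, hdist⟩ := cauchySeq_bdd hD
    obtain ⟨φ, hφ, E, hE⟩ := montelHolds hβ hBC ℓ D ⟨‖D 0‖ + R, fun N => by
      have := norm_le_norm_add_norm_sub' (D N) (D 0)
      have h2 := hdist N 0
      rw [dist_eq_norm] at h2
      linarith⟩
    have hpt : ∀ s : RightHalfPlane,
        Tendsto (fun j => (D (φ j)).limitFun s) atTop (𝓝 (E.limitFun s)) := by
      intro s
      have hs2 : 0 < (s : ℂ).re / 2 := half_pos s.2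
      set w : RightHalfPlane := ⟨s - ((s : ℂ).re / 2 : ℝ), by
        have := s.2
        simp
        linarith⟩ with hw
      have hsw : DSpace.shift ((s : ℂ).re / 2) hs2 w = s := Subtype.ext (by
        simp only [DSpace.shift, hw]
        ring)
      have h1 := (tendsto_iff_norm_sub_tendsto_zero.1 (hE _ hs2)).mul_const
        ((1 + ‖(w : ℂ)‖) ^ (ℓ : ℝ))
      rw [zero_mul] at h1
      refine tendsto_iff_norm_sub_tendsto_zero.2 (squeeze_zero (fun _ => norm_nonneg _)
        (fun j => ?_) h1)
      have h2 := DSpace.norm_limitFun_le (DSpace.translate ((s : ℂ).re / 2) hs2 (D (φ j)) -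
        DSpace.translate ((s : ℂ).re / 2) hs2 E) w
      rwa [DSpace.limitFun_sub, DSpace.limitFun_translate, DSpace.limitFun_translate, hsw] at h2
    refine ⟨E, Metric.tendsto_atTop.2 fun ε hε => ?_⟩
    obtain ⟨N₀, hN₀⟩ := Metric.cauchySeq_iff.1 hD (ε / 2) (half_pos hε)
    refine ⟨N₀, fun N hN => ?_⟩
    rw [dist_eq_norm]
    refine lt_of_le_of_lt (DSpace.norm_le_of_forall fun s => ?_) (half_lt_self hε)
    rw [DSpace.limitFun_sub]
    refine le_of_tendsto ((hpt s).const_sub ((D N).limitFun s)).norm ?_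
    filter_upwards [eventually_ge_atTop N₀] with j hj
    rw [← DSpace.limitFun_sub]
    refine (DSpace.norm_limitFun_le _ s).trans ?_
    have h1 := hN₀ N hN (φ j) (hj.trans (hφ.id_le j))
    rw [dist_eq_norm] at h1
    gcongr

/-! ### Abscissas of convergence -/

theorem abscissaAbsConv_le {lam : Frequency} {a : ℕ → ℂ} {σ : ℝ}
    (h : Summable fun n => ‖a n * Complex.exp (-(lam n : ℂ) * σ)‖) :
    abscissaAbsConv lam a ≤ σ :=
  sInf_le ⟨σ, h, rfl⟩

theorem norm_mul_exp_ofReal (lam : Frequency) (a : ℕ → ℂ) (σ : ℝ) (n : ℕ) :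
    ‖a n * Complex.exp (-(lam n : ℂ) * σ)‖ = ‖a n‖ * Real.exp (-(lam n * σ)) := by
  rw [norm_mul, Complex.norm_exp, neg_mul, Complex.neg_re, Complex.re_ofReal_mul,
    Complex.ofReal_re]

/-- Leibniz's test at every σ > 0. -/
theorem abscissaConv_alternating_le (lam : Frequency) :
    abscissaConv lam (fun n => (-1) ^ n) ≤ 0 := by
  by_contra! hneg
  obtain ⟨q, hq0, hq⟩ := EReal.lt_iff_exists_real_btwn.1 hneg
  have hq0 : 0 < q := by exact_mod_cast hq0
  suffices h : abscissaConv lam (fun n => (-1) ^ n) ≤ q from absurd h (not_le.2 hq)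
  refine sInf_le ⟨q, ?_, rfl⟩
  have hanti : Antitone fun n => Real.exp (-(lam n * q)) := fun m n hmn => by
    have := lam.strictMono.monotone hmn
    dsimp only
    gcongr
  have hzero : Tendsto (fun n => Real.exp (-(lam n * q))) atTop (𝓝 0) :=
    Real.tendsto_exp_neg_atTop_nhds_zero.comp (lam.tendsto_atTop.atTop_mul_const hq0)
  obtain ⟨l, hl⟩ := hanti.tendsto_alternating_series_of_tendsto_zero hzero
  refine ⟨l, ((Complex.continuous_ofReal.tendsto l).comp hl).congr fun N => ?_⟩
  simp

/-- The alternating series competes in the supremum L(λ), and its σ_c is at most 0. Its terms have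
the same moduli as those of ∑ e^{-λ_n s}. -/
theorem abscissaAbsConv_alternating_le_stripWidth (lam : Frequency) :
    abscissaAbsConv lam (fun n => (-1) ^ n) ≤ stripWidth lam := by
  refine le_trans ?_ (le_iSup (fun a => abscissaAbsConv lam a - abscissaConv lam a)
    fun n => (-1) ^ n)
  simpa using EReal.sub_le_sub (le_refl (abscissaAbsConv lam fun n => (-1) ^ n))
    (abscissaConv_alternating_le lam)

/-- By the coefficient estimate, the terms of D at σ + βℓ are dominated by those of the alternating
series at σ. -/
theorem HasDirichletExpansion.abscissaAbsConv_le {lam : Frequency} {ℓ β : ℝ} (hβ : 0 ≤ β)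
    (hBC : BohrCondition lam β) (hℓ : 0 ≤ ℓ) {a : ℕ → ℂ} {F : ℂ → ℂ} {A : ℝ}
    (h : HasDirichletExpansion lam ℓ a F A) :
    abscissaAbsConv lam a ≤ stripWidth lam + ((β * ℓ : ℝ) : EReal) := by
  obtain ⟨C, hC, hcoeff⟩ := exists_norm_coeff_le lam hβ hBC hℓ
  refine le_trans ?_ (add_le_add_left (abscissaAbsConv_alternating_le_stripWidth lam) _)
  -- With the finite number βℓ on the left, the infimum can be tested at each σ of absolute
  -- convergence.
  rw [← EReal.sub_le_iff_le_add (Or.inl (EReal.coe_ne_bot _)) (Or.inl (EReal.coe_ne_top _))]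
  refine le_sInf ?_
  rintro _ ⟨σ, hσ, rfl⟩
  refine EReal.sub_le_of_le_add ?_
  rw [← EReal.coe_add]
  refine RieszDirichlet.abscissaAbsConv_le ?_
  have hσ : Summable fun n => ‖(-1 : ℂ) ^ n * Complex.exp (-(lam n : ℂ) * σ)‖ := hσ
  refine Summable.of_nonneg_of_le (fun n => norm_nonneg _) (fun n => ?_) (hσ.mul_left (C * A))
  rw [norm_mul_exp_ofReal lam a, norm_mul_exp_ofReal lam fun n => (-1) ^ n]
  calc ‖a n‖ * Real.exp (-(lam n * (σ + β * ℓ)))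
      ≤ (C * A * Real.exp (β * ℓ * lam n)) * Real.exp (-(lam n * (σ + β * ℓ))) := by
        gcongr
        exact hcoeff a F A h n
    _ = C * A * Real.exp (-(lam n * σ)) := by
        rw [mul_assoc, ← Real.exp_add]; ring_nf
    _ = _ := by simp

/-- Convergence at σ bounds the terms there, and at σ + 2β they gain the summable factor e^{-2βλ_n}.
-/
theorem stripWidth_le {lam : Frequency} {β : ℝ} (hβ : 0 < β) (hBC : BohrCondition lam β) :
    stripWidth lam ≤ ((2 * β : ℝ) : EReal) := by
  refine iSup_le fun a => EReal.sub_le_of_le_add ?_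
  rw [add_comm, ← EReal.sub_le_iff_le_add (Or.inl (EReal.coe_ne_bot _))
    (Or.inl (EReal.coe_ne_top _))]
  refine le_sInf ?_
  rintro _ ⟨σ, ⟨z, hz⟩, rfl⟩
  refine EReal.sub_le_of_le_add ?_
  rw [← EReal.coe_add]
  refine abscissaAbsConv_le ?_
  have h0 : Tendsto (fun n => a n * Complex.exp (-(lam n : ℂ) * σ)) atTop (𝓝 0) := by
    have h1 := (hz.comp (tendsto_add_atTop_nat 1)).sub hz
    rw [sub_self] at h1
    refine h1.congr fun n => ?_
    simp [Finset.sum_range_succ]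
  obtain ⟨M, hM⟩ := h0.norm.bddAbove_range
  refine Summable.of_nonneg_of_le (fun n => norm_nonneg _) (fun n => ?_)
    ((summable_exp_neg_two_mul hβ hBC).mul_left M)
  have h2 : ‖a n * Complex.exp (-(lam n : ℂ) * σ)‖ ≤ M := hM ⟨n, rfl⟩
  rw [norm_mul_exp_ofReal] at h2 ⊢
  calc ‖a n‖ * Real.exp (-(lam n * (σ + 2 * β)))
      = ‖a n‖ * Real.exp (-(lam n * σ)) * Real.exp (-(2 * β * lam n)) := by
        rw [mul_assoc, ← Real.exp_add]; ring_nf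
    _ ≤ _ := by gcongr

end RieszDirichlet

end

theorem mainTheorem6 (lam : RieszDirichlet.Frequency) (β : ℝ) (hβ : 0 < β)
    (hBC : RieszDirichlet.BohrCondition lam β) (ℓ : ℝ≥0) (hℓ : 0 < ℓ) :
    RieszDirichlet.GermsSummable lam ℓ ∧
      RieszDirichlet.MontelHolds lam ℓ ∧
      RieszDirichlet.IsBanachDSpace lam ℓ ∧
      RieszDirichlet.SpacesCoincide lam ℓ ∧
      (∀ f ∈ RieszDirichlet.HSpace lam ℓ, ∀ a : ℕ → ℂ, RieszDirichlet.IsRieszGerm lam a f →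
        RieszDirichlet.abscissaAbsConv lam a ≤
          RieszDirichlet.stripWidth lam + ((β * (ℓ : ℝ) : ℝ) : EReal)) ∧
      RieszDirichlet.stripWidth lam + ((β * (ℓ : ℝ) : ℝ) : EReal) < ⊤ := by
  refine ⟨RieszDirichlet.germsSummable hβ hBC ℓ, RieszDirichlet.montelHolds hβ hBC ℓ,
    RieszDirichlet.isBanachDSpace hβ hBC ℓ, RieszDirichlet.spacesCoincide hβ hBC ℓ, ?_, ?_⟩
  · rintro f ⟨hhol, -, A, hA⟩ a ha
    obtain ⟨F, -, h⟩ := ha.exists_expansion hβ hBC hhol fun s => hA ⟨s, rfl⟩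
    exact h.abscissaAbsConv_le hβ.le hBC hℓ.le
  · exact EReal.add_lt_top (ne_top_of_le_ne_top (EReal.coe_ne_top _)
      (RieszDirichlet.stripWidth_le hβ hBC)) (EReal.coe_ne_top _)
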